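/- **Setting.** Let $M$ be a (Hausdorff) complex manifold of dimension $n$, let $S\subset M$ be an embedded, not necessarily closed, complex submanifold of codimension $m\ge 1$, and let $k\ge 1$. Let $\mathcal O_M$ be the sheaf of germs of holomorphic functions on $M$, $\mathcal I_S\subset\mathcal O_M$ the ideal sheaf of $S$, $\mathcal O_S=\mathcal O_M/\mathcal I_S$ (a sheaf on $S$), and write $[f]_j$ for the class of $f$ in $\mathcal O_M/\mathcal I_S^{j}$. A *$k$-th order lifting* is a morphism $\rho\colon\mathcal O_S\to\mathcal O_M/\mathcal I_S^{k+1}$ of sheaves of rings on $S$ with $\theta_k\circ\rho=\mathrm{id}$, where $\theta_k[f]_{k+1}=[f]_1$. Giving $\rho$ is the same as giving a retraction of the $k$-th infinitesimal neighbourhood $S(k)=(S,\mathcal O_M/\mathcal I_S^{k+1})$ onto $S$. The submanifold $S$ is *$k$-splitting* into $M$ if a $k$-th order lifting exists. For a chart $(U_\alpha,z_\alpha)$ of $M$ write $z_\alpha=(z'_\alpha,z''_\alpha)$ with $z'_\alpha=(z^1_\alpha,\dots,z^m_\alpha)$ and $z''_\alpha=(z^{m+1}_\alpha,\dots,z^n_\alpha)$.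 The chart is *adapted to $S$* if $U_\alpha\cap S=\emptyset$ or $U_\alpha\cap S=U_\alpha\cap\overline S=\{z^1_\alpha=\dots=z^m_\alpha=0\}$. An *atlas adapted to $S$* is a set $\mathfrak U=\{(U_\alpha,z_\alpha)\}$ of holomorphic charts adapted to $S$ whose domains cover $M\setminus(\overline S\setminus S)$ (that is, cover $M$ when $S$ is closed). It is *projectable* if, whenever $U_\alpha\cap S\ne\emptyset$ and $U_\alpha$ contains the point with coordinates $(z'_\alpha,z''_\alpha)$, the point with coordinates $(O',z''_\alpha)$ exists in $U_\alpha$ and belongs to $S$. It is *$k$-splitting* if $$\frac{\partial z_\beta^p}{\partial z_\alpha^r}\in\mathcal I_S^k\quad\text{on }U_\alpha\cap U_\beta$$ for all $r=1,\dots,m$, $p=m+1,\dots,n$ and all $\alpha,\beta$ with $U_\alpha\cap U_\beta\cap S\neq\emptyset$. It is *adapted to a $k$-th order lifting $\rho$* if on $U_\alpha\cap S$ $$\rho([f]_1)=\sum_{l=0}^k(-1)^l\frac1{l!}\sum_{r_1,\dots,r_l=1}^m\left[\frac{\partial^l f}{\partial z_\alpha^{r_1}\cdots\partial z_\alpha^{r_l}}\,z_\alpha^{r_1}\cdots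 z_\alpha^{r_l}\right]_{k+1}$$ for all $\alpha$ with $U_\alpha\cap S\ne\emptyset$ and all $f\in\mathcal O_M(U_\alpha)$. **Theorem.** (i) $S$ is $k$-splitting into $M$ if and only if there exists a $k$-splitting atlas adapted to $S$. (ii) An atlas adapted to $S$ is $k$-splitting if and only if it is adapted to some $k$-th order lifting. (iii) A projectable atlas adapted to $S$ is $k$-splitting if and only if the local liftings $\rho_\alpha([f]_1)=[f(O',z''_\alpha)]_{k+1}$ on the sets $U_\alpha\cap S$ patch together to a global $k$-th order lifting, i.e. are the restrictions of one $k$-th order lifting $\rho$. (iv) If $S$ is $k$-splitting into $M$, then for every $k$-th order lifting $\rho$ there is an atlas adapted to $S$ that is adapted to $\rho$; when $\dim S=0$ this is claimed for the liftings $\rho$ that are $\mathbb C$-linear, that is, $\rho([c]_1)=[c]_{k+1}$ for all constants $c\in\mathbb C$. -/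

import Mathlib

open Filter Topology
open scoped Manifold ContDiff

noncomputable section

/-- The model space `ℂ^(m+d)`; the first `m` coordinates are written `z'`, the last `d` are `z''`. -/
abbrev CSpace (m d : ℕ) : Type := Fin (m + d) → ℂ

/-- `f` is holomorphic (complex analytic) at the point `x` of the complex manifold `M`, hence in a
neighbourhood of `x`. -/
def HolAt (m d : ℕ) {M : Type*} [TopologicalSpace M] [ChartedSpace (CSpace m d) M]
    (f : M → ℂ) (x : M) : Prop :=
  ContMDiffAt 𝓘(ℂ, CSpace m d) 𝓘(ℂ, ℂ) ω f x

/-- The stalk `O_{M,x}`: the ring of germs at `x` of holomorphic functions. -/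
def holStalk (m d : ℕ) {M : Type*} [TopologicalSpace M] [ChartedSpace (CSpace m d) M] (x : M) :
    Subring (Germ (𝓝 x) ℂ) where
  carrier := {φ | ∃ f : M → ℂ, φ = (f : Germ (𝓝 x) ℂ) ∧ HolAt m d f x}
  mul_mem' := by
    rintro _ _ ⟨f, rfl, hf⟩ ⟨g, rfl, hg⟩
    exact ⟨f * g, rfl, ContMDiffAt.mul hf hg⟩
  one_mem' := ⟨1, rfl, contMDiffAt_const⟩
  add_mem' := by
    rintro _ _ ⟨f, rfl, hf⟩ ⟨g, rfl, hg⟩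
    exact ⟨f + g, rfl, ContMDiffAt.add hf hg⟩
  zero_mem' := ⟨0, rfl, contMDiffAt_const⟩
  neg_mem' := by
    rintro _ ⟨f, rfl, hf⟩
    exact ⟨-f, rfl, ContMDiffAt.neg hf⟩

/-- The germ at `x` of a function which is holomorphic at `x`. -/
def holGerm {m d : ℕ} {M : Type*} [TopologicalSpace M] [ChartedSpace (CSpace m d) M]
    (f : M → ℂ) (x : M) (hf : HolAt m d f x) : holStalk m d x :=
  ⟨(f : Germ (𝓝 x) ℂ), f, rfl, hf⟩

/-- The stalk `I_{S,x}` of the ideal sheaf of `S`: the germs vanishing on `S`. -/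
def idealStalk (m d : ℕ) {M : Type*} [TopologicalSpace M] [ChartedSpace (CSpace m d) M]
    (S : Set M) (x : M) : Ideal (holStalk m d x) where
  carrier := {φ | ∃ f : M → ℂ, (φ : Germ (𝓝 x) ℂ) = (f : Germ (𝓝 x) ℂ) ∧
    ∀ᶠ y in 𝓝 x, y ∈ S → f y = 0}
  add_mem' := by
    rintro a b ⟨f, hf, hf0⟩ ⟨g, hg, hg0⟩
    refine ⟨f + g, by simp [hf, hg], ?_⟩
    filter_upwards [hf0, hg0] with y h1 h2 hy
    simp [h1 hy, h2 hy]
  zero_mem' := ⟨0, rfl, Eventually.of_forall fun _ _ => rfl⟩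
  smul_mem' := by
    rintro ⟨_, f, rfl, hf⟩ b ⟨g, hg, hg0⟩
    refine ⟨f * g, by simp [hg], ?_⟩
    filter_upwards [hg0] with y h2 hy
    simp [h2 hy]

/-- The stalk at `x` of `O_M / I_S^j`. For `j = k + 1` and `x ∈ S` this is the stalk of the
structure sheaf of the `k`-th infinitesimal neighbourhood `S(k)` of `S` in `M`. -/
abbrev nbhdStalk (m d : ℕ) {M : Type*} [TopologicalSpace M] [ChartedSpace (CSpace m d) M]
    (S : Set M) (j : ℕ) (x : M) : Type _ :=
  holStalk m d x ⧸ (idealStalk m d S x ^ j)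

/-- The class `[f]_j` in the stalk of `O_M / I_S^j` at `x`. -/
def nbhdClass {m d : ℕ} {M : Type*} [TopologicalSpace M] [ChartedSpace (CSpace m d) M]
    (S : Set M) (j : ℕ) (f : M → ℂ) (x : M) (hf : HolAt m d f x) : nbhdStalk m d S j x :=
  Ideal.Quotient.mk _ (holGerm f x hf)

/-- The stalk of `θ_k : O_M / I_S^(k+1) → O_S = O_M / I_S`, `[f]_{k+1} ↦ [f]_1`. -/
def thetaStalk (m d : ℕ) {M : Type*} [TopologicalSpace M] [ChartedSpace (CSpace m d) M]
    (S : Set M) (k : ℕ) (x : M) : nbhdStalk m d S (k + 1) x →+* nbhdStalk m d S 1 x :=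
  Ideal.Quotient.factor (Ideal.pow_le_pow_right (Nat.succ_le_succ (Nat.zero_le k)))

/-- A `k`-th order lifting: a morphism `ρ : O_S → O_M / I_S^(k+1)` of sheaves of rings on `S` with
`θ_k ∘ ρ = id`. The sheaves are described by their stalks, a section of `O_M / I_S^j` being a family
of germs that is locally the family of classes of one holomorphic function. A morphism of sheaves of
rings is then a family of (not necessarily unital) ring homomorphisms between the stalks which maps
sections to sections. -/
structure Lifting (m d : ℕ) {M : Type*} [TopologicalSpace M] [ChartedSpace (CSpace m d) M]
    (S : Set M) (k : ℕ) where
  /-- the ring homomorphism on the stalks at `x ∈ S` -/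
  toHom : ∀ x : S, nbhdStalk m d S 1 (x : M) →ₙ+* nbhdStalk m d S (k + 1) (x : M)
  /-- sections are mapped to sections -/
  locally_hol : ∀ (U : Set M), IsOpen U → ∀ (f : M → ℂ) (hf : ∀ y ∈ U, HolAt m d f y),
    ∀ x : S, (x : M) ∈ U → ∃ V : Set M, IsOpen V ∧ (x : M) ∈ V ∧ ∃ hVU : V ⊆ U,
      ∃ (g : M → ℂ) (hg : ∀ y ∈ V, HolAt m d g y), ∀ (y : S) (hy : (y : M) ∈ V),
        toHom y (nbhdClass S 1 f y (hf y (hVU hy))) = nbhdClass S (k + 1) g y (hg y hy)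
  /-- `θ_k ∘ ρ = id` -/
  theta_toHom : ∀ (x : S) (s : nbhdStalk m d S 1 (x : M)),
    thetaStalk m d S k (x : M) (toHom x s) = s

/-- `ρ [f]_1 = [g]_{k+1}` in the stalk at `x ∈ S` (with both sides meaningful). -/
def Lifting.Maps {m d : ℕ} {M : Type*} [TopologicalSpace M] [ChartedSpace (CSpace m d) M]
    {S : Set M} {k : ℕ} (ρ : Lifting m d S k) (x : S) (f g : M → ℂ) : Prop :=
  ∃ (hf : HolAt m d f (x : M)) (hg : HolAt m d g (x : M)),
    ρ.toHom x (nbhdClass S 1 f x hf) = nbhdClass S (k + 1) g x hg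

/-- `ρ` fixes the constants, that is, it is a morphism of sheaves of `ℂ`-algebras. -/
def Lifting.FixesConstants {m d : ℕ} {M : Type*} [TopologicalSpace M]
    [ChartedSpace (CSpace m d) M] {S : Set M} {k : ℕ} (ρ : Lifting m d S k) : Prop :=
  ∀ (x : S) (c : ℂ), ρ.Maps x (fun _ => c) (fun _ => c)

/-- `S` is `k`-splitting into `M`: there is a `k`-th order lifting (equivalently a `k`-th order
infinitesimal retraction `(id, ρ) : S(k) → S`). -/
def IsKSplitting (m d : ℕ) {M : Type*} [TopologicalSpace M] [ChartedSpace (CSpace m d) M]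
    (S : Set M) (k : ℕ) : Prop :=
  Nonempty (Lifting m d S k)

/-- The zero locus `{z' = 0}` in the domain of a chart. -/
def normalZeros {m d : ℕ} {M : Type*} [TopologicalSpace M]
    (z : OpenPartialHomeomorph M (CSpace m d)) : Set M :=
  {x | x ∈ z.source ∧ ∀ r : Fin m, z x (Fin.castAdd d r) = 0}

/-- `S` is a complex submanifold (embedded, not necessarily closed) of codimension `m` of the
`(m+d)`-dimensional complex manifold `M`. -/
def IsComplexSubmanifold (m d : ℕ) {M : Type*} [TopologicalSpace M]
    [ChartedSpace (CSpace m d) M] (S : Set M) : Prop :=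
  ∀ x ∈ S, ∃ z ∈ IsManifold.maximalAtlas 𝓘(ℂ, CSpace m d) ω M,
    x ∈ z.source ∧ z.source ∩ S = normalZeros z

/-- The chart `(U, z)` is adapted to `S`. -/
def IsAdaptedChart {m d : ℕ} {M : Type*} [TopologicalSpace M] (S : Set M)
    (z : OpenPartialHomeomorph M (CSpace m d)) : Prop :=
  z.source ∩ S = ∅ ∨ (z.source ∩ S = z.source ∩ closure S ∧ z.source ∩ S = normalZeros z)

/-- `𝔘` is an atlas adapted to `S`: a set of holomorphic charts adapted to `S` whose domains cover
`M` (if `S` is not closed: the open submanifold `M \ (closure S \ S)`, in which `S` is closed, since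
no adapted chart contains a point of `closure S \ S`). -/
structure IsAdaptedAtlas {m d : ℕ} {M : Type*} [TopologicalSpace M]
    [ChartedSpace (CSpace m d) M] (S : Set M)
    (𝔘 : Set (OpenPartialHomeomorph M (CSpace m d))) : Prop where
  holomorphic : 𝔘 ⊆ IsManifold.maximalAtlas 𝓘(ℂ, CSpace m d) ω M
  covers : ∀ x : M, x ∉ closure S \ S → ∃ z ∈ 𝔘, x ∈ z.source
  adapted : ∀ z ∈ 𝔘, IsAdaptedChart S z

/-- The linear projection `(z', z'') ↦ (0, z'')` of `ℂ^(m+d)`. -/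
def killNormal {m d : ℕ} (v : CSpace m d) : CSpace m d :=
  Fin.addCases (fun _ => 0) (fun p => v (Fin.natAdd m p))

/-- The atlas `𝔘` is projectable: in charts meeting `S`, if a point with coordinates `(z', z'')` is
in `U` then so is the point with coordinates `(0, z'')`, and it lies on `S`. -/
def IsProjectable {m d : ℕ} {M : Type*} [TopologicalSpace M] (S : Set M)
    (𝔘 : Set (OpenPartialHomeomorph M (CSpace m d))) : Prop :=
  ∀ z ∈ 𝔘, (z.source ∩ S).Nonempty → ∀ x ∈ z.source,
    killNormal (z x) ∈ z.target ∧ z.symm (killNormal (z x)) ∈ S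

/-- The iterated partial derivative `∂^l f / ∂z^{i_1} ⋯ ∂z^{i_l}` in the chart `z`. -/
def chartPartial {m d : ℕ} {M : Type*} [TopologicalSpace M]
    (z : OpenPartialHomeomorph M (CSpace m d)) {l : ℕ} (i : Fin l → Fin (m + d)) (f : M → ℂ) :
    M → ℂ :=
  fun x => iteratedFDeriv ℂ l (f ∘ z.symm) (z x) (fun a => Pi.single (i a) 1)

/-- `f` is, at `x`, a germ in the `k`-th power of the ideal `I_{S,x}`. -/
def MemIdealPow (m d : ℕ) {M : Type*} [TopologicalSpace M] [ChartedSpace (CSpace m d) M]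
    (S : Set M) (k : ℕ) (f : M → ℂ) (x : M) : Prop :=
  ∃ hf : HolAt m d f x, holGerm f x hf ∈ idealStalk m d S x ^ k

/-- `𝔘` satisfies the `k`-splitting condition: `∂z_β^p / ∂z_α^r ∈ I_S^k` on `U_α ∩ U_β` for all
`r = 1, …, m`, `p = m+1, …, m+d`, whenever `U_α ∩ U_β ∩ S` is non-empty. -/
def IsKSplittingAtlas {m d : ℕ} {M : Type*} [TopologicalSpace M]
    [ChartedSpace (CSpace m d) M] (S : Set M) (k : ℕ)
    (𝔘 : Set (OpenPartialHomeomorph M (CSpace m d))) : Prop :=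
  ∀ zα ∈ 𝔘, ∀ zβ ∈ 𝔘, (zα.source ∩ zβ.source ∩ S).Nonempty →
    ∀ (r : Fin m) (p : Fin d), ∀ x ∈ zα.source ∩ zβ.source,
      MemIdealPow m d S k
        (chartPartial zα (l := 1) (fun _ => Fin.castAdd d r) (fun y => zβ y (Fin.natAdd m p))) x

/-- The function
`∑_{l=0}^k (-1)^l (1/l!) ∑_{r_1,…,r_l=1}^m (∂^l f / ∂z^{r_1} ⋯ ∂z^{r_l}) z^{r_1} ⋯ z^{r_l}`. -/
def alternatingTaylor {m d : ℕ} {M : Type*} [TopologicalSpace M]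
    (z : OpenPartialHomeomorph M (CSpace m d)) (k : ℕ) (f : M → ℂ) : M → ℂ :=
  fun x => ∑ l ∈ Finset.range (k + 1), (-1 : ℂ) ^ l * (1 / (l.factorial : ℂ)) *
    ∑ r : Fin l → Fin m,
      chartPartial z (fun a => Fin.castAdd d (r a)) f x * ∏ a, z x (Fin.castAdd d (r a))

/-- The atlas `𝔘` is adapted to the lifting `ρ`: on every `U_α` meeting `S`, and for every `f`
holomorphic on `U_α`, `ρ [f]_1` is the class of the alternating Taylor sum of `f`. -/
def IsAdaptedTo {m d : ℕ} {M : Type*} [TopologicalSpace M] [ChartedSpace (CSpace m d) M]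
    {S : Set M} {k : ℕ} (𝔘 : Set (OpenPartialHomeomorph M (CSpace m d)))
    (ρ : Lifting m d S k) : Prop :=
  ∀ z ∈ 𝔘, ∀ f : M → ℂ, (∀ y ∈ z.source, HolAt m d f y) →
    ∀ x : S, (x : M) ∈ z.source → ρ.Maps x f (alternatingTaylor z k f)

/-- The local liftings `ρ_α [f]_1 = [f(0, z''_α)]_{k+1}`, for `f` any germ of holomorphic function
at a point of `U_α ∩ S`, are the restrictions of the global lifting `ρ`. -/
def LocalLiftingsPatchTo {m d : ℕ} {M : Type*} [TopologicalSpace M]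
    [ChartedSpace (CSpace m d) M] {S : Set M} {k : ℕ}
    (𝔘 : Set (OpenPartialHomeomorph M (CSpace m d))) (ρ : Lifting m d S k) : Prop :=
  ∀ z ∈ 𝔘, ∀ x : S, (x : M) ∈ z.source → ∀ f : M → ℂ, HolAt m d f (x : M) →
    ρ.Maps x f (fun y => f (z.symm (killNormal (z y))))

end

/-!
At a point of `S`, a chart in which `S = {z' = 0}` gives the substitution `f ↦ f(0, z'')`, a ring
endomorphism of the stalk `O_{M,x}` which kills `I_S` and is the identity modulo `I_S`. It induces
a local lifting `[f]_1 ↦ [f(0, z'')]_{k+1}`. The proof consists in comparing an arbitrary lifting,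
and the various sums and conditions of the statement, with these local liftings.

* The Euler derivation `∑ z^r ∂/∂z^r` of the normal coordinates acts on `I_S^j / I_S^{j+1}` as
  multiplication by `j`. Since the integers `1, …, k` are invertible, a germ in `I_S` with Euler
  derivative in `I_S^{k+1}` is itself in `I_S^{k+1}` (`NormalCoordinates.mem_pow_of_euler_mem`).
  The Euler derivation telescopes on the alternating Taylor sum, so this sum represents
  `[f(0, z'')]_{k+1}` (`alternatingTaylor_sub_chartRetr_mem`). In the same way
  `f - f(0, z'') ∈ I_S^{k+1}` as soon as the normal derivatives of `f` are in `I_S^k`; with the chain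
  rule it follows that the local liftings of two charts agree when the transition map satisfies the
  `k`-splitting condition (`chartRetr_sub_chartRetr_mem`), so those of a `k`-splitting atlas patch
  together. Conversely, if the local liftings agree, then differentiating
  `z_β^p - z_β^p(0, z_α'') ∈ I_S^{k+1}` in the normal directions gives the `k`-splitting condition
  (`isKSplittingAtlas_of_stalkHom`). Off `S` the condition is trivial: a chart of an adapted atlas
  that meets `S` meets the closure of `S` only in `S`, so `I_S` is the unit ideal there.
* A lifting is determined on the stalk at `x` by its values on the constants and on the tangential
  coordinates (`Lifting.stalkHom_eq_of_coord`): the coordinates generate the maximal ideal, and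
  powers of `I_S` are closed in the adic topology. Hence an atlas is adapted to `ρ` if and only if
  `ρ` restricts to all of its local liftings (`isAdaptedTo_iff`).
* Given `ρ`, replace the tangential coordinates `z''` of a chart by representatives of
  `ρ [z'']_1`. They agree with `z''` on `S`, so by the inverse function theorem they form a chart
  together with `z'`, and `ρ` fixes its tangential coordinates (`Lifting.exists_chart`). It remains
  to see that `ρ` fixes the constants.
* Liftings are only assumed to be homomorphisms of rings, but if `dim S ≥ 1` they are linear over
  `ℂ` (`Lifting.stalkHom_constStalk`). A lifting fixes `√-1`, hence the Gaussian integers, because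
  square roots of `-1` cannot be deformed by nilpotents. For a constant `c` with `ρ c = c + Δ` and a
  tangential coordinate `t` fixed by `ρ`, there are Gaussian integers `r_j` such that
  `a_j = j! c + r_j` is bounded; the image of the convergent series `∑ a_j t^j` would be
  `∑ a_j t^j + Δ ∑ j! t^j`, and since `∑ j! t^j` diverges this is only possible if `Δ = 0`. In
  dimension zero there is no such coordinate; then the `k`-splitting condition is empty, which
  settles the existence of a `k`-splitting atlas without using the lifting.

That `I_S` is generated by `z'` and the maximal ideal by all coordinates is the Hadamard lemma, which
is deduced from an analytic divided difference `f v - f w = G (v, w) (v - w)`, constructed on the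
level of power series.
-/

/-! ### Algebra of normal coordinates -/

/-- Algebraic shadow of a holomorphic chart in which a submanifold with ideal `I` is the zero locus
of the normal coordinates: the normal coordinates themselves, the derivations along them, and the
retraction `f ↦ f(0, z'')`, whose image is the ring of functions independent of `z'`. -/
structure NormalCoordinates {R : Type*} [CommRing R] (I : Ideal R) (ι : Type*) [Fintype ι]
    [DecidableEq ι] where
  /-- the normal coordinates `z'` -/
  coord : ι → R
  /-- the derivations `∂ / ∂z'` -/
  deriv : ι → Derivation ℤ R R
  /-- the substitution `z' = 0` -/
  retr : R →+* R
  span_coord : Ideal.span (Set.range coord) = I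
  deriv_coord : ∀ i j, deriv i (coord j) = if i = j then 1 else 0
  deriv_retr : ∀ i a, deriv i (retr a) = 0
  retr_of_mem : ∀ a ∈ I, retr a = 0
  sub_retr_mem : ∀ a, a - retr a ∈ I

theorem Derivation.apply_mem_pow {R : Type*} [CommRing R] (D : Derivation ℤ R R) (J : Ideal R)
    (n : ℕ) : ∀ a ∈ J ^ (n + 1), D a ∈ J ^ n := by
  induction n with
  | zero => simp
  | succ n ih =>
    intro a ha
    rw [pow_succ'] at ha
    refine Submodule.mul_induction_on ha ?_ ?_
    · intro u hu v hv
      rw [D.leibniz, smul_eq_mul, smul_eq_mul]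
      refine add_mem ?_ (Ideal.mul_mem_right _ _ hv)
      rw [pow_succ']
      exact Ideal.mul_mem_mul hu (ih v hv)
    · intro u v hu hv
      rw [map_add]
      exact add_mem hu hv

namespace NormalCoordinates

variable {R : Type*} [CommRing R] {I : Ideal R} {ι : Type*} [Fintype ι] [DecidableEq ι]
  (N : NormalCoordinates I ι)

/-- The Euler derivation `∑ z^r ∂/∂z^r` of the normal coordinates. -/
noncomputable def euler : Derivation ℤ R R := ∑ i, N.coord i • N.deriv i

theorem euler_apply (a : R) : N.euler a = ∑ i, N.coord i * N.deriv i a := by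
  change Derivation.coeFnAddMonoidHom (∑ i, N.coord i • N.deriv i) a = _
  rw [map_sum, Finset.sum_apply]
  rfl

theorem coord_mem (i : ι) : N.coord i ∈ I :=
  N.span_coord.le (Ideal.subset_span ⟨i, rfl⟩)

theorem euler_mem_pow_succ {k : ℕ} {a : R} (h : ∀ i, N.deriv i a ∈ I ^ k) :
    N.euler a ∈ I ^ (k + 1) := by
  rw [euler_apply]
  refine sum_mem fun i _ => ?_
  rw [pow_succ']
  exact Ideal.mul_mem_mul (N.coord_mem i) (h i)

theorem euler_mem (a : R) : N.euler a ∈ I := by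
  simpa using N.euler_mem_pow_succ (k := 0) (a := a) (by simp)

theorem euler_coord (i : ι) : N.euler (N.coord i) = N.coord i := by
  simp [euler_apply, N.deriv_coord]

theorem euler_retr (a : R) : N.euler (N.retr a) = 0 := by
  simp [euler_apply, N.deriv_retr]

theorem euler_sub_self_mem {a : R} (ha : a ∈ I) : N.euler a - a ∈ I ^ 2 := by
  have ha' : a ∈ Ideal.span (Set.range N.coord) := by rwa [N.span_coord]
  refine Submodule.span_induction ?_ ?_ ?_ ?_ ha'
  · rintro _ ⟨i, rfl⟩
    simp [euler_coord]
  · simp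
  · intro x y _ _ hx hy
    rw [map_add, add_sub_add_comm]
    exact add_mem hx hy
  · intro c x hx hx2
    replace hx : x ∈ I := N.span_coord.le hx
    have : N.euler (c • x) - c • x = c * (N.euler x - x) + x * N.euler c := by
      simp only [smul_eq_mul, Derivation.leibniz]; ring
    rw [this]
    refine add_mem (Ideal.mul_mem_left _ _ hx2) ?_
    rw [pow_two]
    exact Ideal.mul_mem_mul hx (N.euler_mem c)

/-- On `I ^ j / I ^ (j + 1)` the Euler derivation is multiplication by `j`. -/
theorem euler_sub_nsmul_mem (j : ℕ) : ∀ a ∈ I ^ j, N.euler a - (j : R) * a ∈ I ^ (j + 1) := by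
  induction j with
  | zero => intro a _; simpa using N.euler_mem a
  | succ j ih =>
    intro a ha
    rw [pow_succ'] at ha
    refine Submodule.mul_induction_on ha ?_ ?_
    · intro u hu v hv
      have : N.euler (u * v) - ((j + 1 : ℕ) : R) * (u * v)
          = u * (N.euler v - j * v) + (N.euler u - u) * v := by
        simp only [smul_eq_mul, Derivation.leibniz]; push_cast; ring
      rw [this]
      refine add_mem ?_ ?_
      · rw [pow_succ' _ (j + 1)]
        exact Ideal.mul_mem_mul hu (ih v hv)
      · rw [show j + 1 + 1 = 2 + j by ring, pow_add]
        exact Ideal.mul_mem_mul (N.euler_sub_self_mem hu) hv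
    · intro u v hu hv
      have : N.euler (u + v) - ((j + 1 : ℕ) : R) * (u + v)
          = (N.euler u - ((j + 1 : ℕ) : R) * u) + (N.euler v - ((j + 1 : ℕ) : R) * v) := by
        rw [map_add]; ring
      rw [this]
      exact add_mem hu hv

/-- An element of `I` lies in `I ^ (k + 1)` as soon as its Euler derivative does: the homogeneous
parts of degree `1, …, k` are eigenvectors with invertible eigenvalue. -/
theorem mem_pow_of_euler_mem (hu : ∀ n : ℕ, IsUnit ((n + 1 : ℕ) : R)) {k : ℕ} {a : R}
    (ha : a ∈ I) (h : N.euler a ∈ I ^ (k + 1)) : a ∈ I ^ (k + 1) := by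
  suffices H : ∀ j ≤ k, a ∈ I ^ (j + 1) from H k le_rfl
  intro j
  induction j with
  | zero => intro _; simpa using ha
  | succ j ih =>
    intro hj
    have h1 := N.euler_sub_nsmul_mem (j + 1) a (ih (by omega))
    have h2 : N.euler a ∈ I ^ (j + 1 + 1) := Ideal.pow_le_pow_right (by omega) h
    have h3 : ((j + 1 : ℕ) : R) * a ∈ I ^ (j + 1 + 1) := by
      have := sub_mem h2 h1
      rwa [sub_sub_cancel] at this
    exact (Ideal.unit_mul_mem_iff_mem _ (hu j)).1 h3

theorem mem_pow_succ_of_deriv_mem (hu : ∀ n : ℕ, IsUnit ((n + 1 : ℕ) : R)) {k : ℕ} {a : R}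
    (ha : a ∈ I) (h : ∀ i, N.deriv i a ∈ I ^ k) : a ∈ I ^ (k + 1) :=
  N.mem_pow_of_euler_mem hu ha (N.euler_mem_pow_succ h)

theorem mem_of_retr_eq_zero {a : R} (h : N.retr a = 0) : a ∈ I := by
  simpa [h] using N.sub_retr_mem a

/-- A function differs from its restriction to `z' = 0` by an element of `I ^ (k + 1)` as soon as
its normal derivatives are in `I ^ k`. -/
theorem sub_retr_mem_pow (hu : ∀ n : ℕ, IsUnit ((n + 1 : ℕ) : R)) {k : ℕ} {a : R}
    (h : ∀ i, N.deriv i a ∈ I ^ k) : a - N.retr a ∈ I ^ (k + 1) :=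
  N.mem_pow_succ_of_deriv_mem hu (N.sub_retr_mem a) fun i => by
    rw [map_sub, N.deriv_retr, sub_zero]; exact h i

/-- Taylor's formula modulo `I ^ (k + 1)`: if `A l` stands for `∑ (∂^l f) z^{r_1} ⋯ z^{r_l}`, the
alternating Taylor sum of `f` is congruent to `f(0, z'')`. The Euler derivation telescopes on it. -/
theorem sum_taylor_sub_retr_mem (hu : ∀ n : ℕ, IsUnit ((n + 1 : ℕ) : R)) (k : ℕ) (A c : ℕ → R)
    (hA : ∀ l, A (l + 1) = N.euler (A l) - (l : R) * A l) (hc0 : c 0 = 1)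
    (hc : ∀ l : ℕ, ((l + 1 : ℕ) : R) * c (l + 1) = -c l) (hcE : ∀ l, N.euler (c l) = 0) :
    ∑ l ∈ Finset.range (k + 1), c l * A l - N.retr (A 0) ∈ I ^ (k + 1) := by
  have hmem : ∀ l, A l ∈ I ^ l := by
    intro l
    induction l with
    | zero => simp
    | succ l ih => rw [hA]; exact N.euler_sub_nsmul_mem l _ ih
  have htel : ∀ k, N.euler (∑ l ∈ Finset.range (k + 1), c l * A l) = c k * A (k + 1) := by
    intro k
    induction k with
    | zero => simp [hc0, hA]
    | succ k ih =>
      rw [Finset.sum_range_succ, map_add, ih, Derivation.leibniz, hcE, hA (k + 1)]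
      simp only [smul_eq_mul]
      linear_combination A (k + 1) * hc k
  refine N.mem_pow_of_euler_mem hu ?_ ?_
  · rw [Finset.sum_range_succ', hc0, one_mul, add_sub_assoc]
    refine add_mem (sum_mem fun l _ => Ideal.mul_mem_left _ _ ?_) (N.sub_retr_mem _)
    exact Ideal.pow_le_self (by omega) (hmem (l + 1))
  · rw [map_sub, N.euler_retr, sub_zero, htel]
    exact Ideal.mul_mem_left _ _ (hmem _)

theorem deriv_mem_sup (J : Ideal R) {n j : ℕ} {a : R} (h : a ∈ J ^ (n + 1) ⊔ I ^ (j + 1)) (i : ι) :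
    N.deriv i a ∈ J ^ n ⊔ I ^ j := by
  obtain ⟨u, hu, v, hv, rfl⟩ := Submodule.mem_sup.1 h
  rw [map_add]
  exact Submodule.add_mem_sup ((N.deriv i).apply_mem_pow J n u hu)
    ((N.deriv i).apply_mem_pow I j v hv)

theorem retr_mem_of_mem_sup {J : Ideal R} (hJ : ∀ a ∈ J, N.retr a ∈ J) {n j : ℕ} {a : R}
    (h : a ∈ J ^ n ⊔ I ^ (j + 1)) : N.retr a ∈ J ^ n := by
  obtain ⟨u, hu, v, hv, rfl⟩ := Submodule.mem_sup.1 h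
  rw [map_add, N.retr_of_mem v (Ideal.pow_le_self (by omega) hv), add_zero]
  have h1 : Ideal.map N.retr (J ^ n) ≤ J ^ n := by
    rw [Ideal.map_pow]
    exact Ideal.pow_right_mono (Ideal.map_le_iff_le_comap.2 hJ) n
  exact h1 (Ideal.mem_map_of_mem _ hu)

/-- If no nonzero element is flat along `J`, then each power of `I` is closed in the `J`-adic
topology. -/
theorem mem_pow_of_forall_mem_sup (hu : ∀ n : ℕ, IsUnit ((n + 1 : ℕ) : R)) {J : Ideal R}
    (hJ : ∀ a ∈ J, N.retr a ∈ J) (hflat : ∀ a, (∀ n, a ∈ J ^ n) → a = 0) (j : ℕ) :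
    ∀ a, (∀ n, a ∈ J ^ n ⊔ I ^ j) → a ∈ I ^ j := by
  induction j with
  | zero => simp
  | succ j ih =>
    intro a ha
    refine N.mem_pow_succ_of_deriv_mem hu (N.mem_of_retr_eq_zero (hflat _ fun n => ?_)) fun i =>
      ih _ fun n => N.deriv_mem_sup J (ha (n + 1)) i
    exact N.retr_mem_of_mem_sup hJ (ha n)

/-- If the formal product `b * ∑ q_i t^i` can only be `J`-adically represented in `R` when `b = 0`,
then it can only be represented modulo `I ^ j` when `b ∈ I ^ j`; here `t` is independent of `z'`. -/
theorem mem_pow_of_formal_mul (hu : ∀ n : ℕ, IsUnit ((n + 1 : ℕ) : R)) {J : Ideal R}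
    (hJ : ∀ a ∈ J, N.retr a ∈ J) {t : R} (htJ : t ∈ J) (ht : N.retr t = t) (q : ℕ → ℕ)
    (hdiv : ∀ a b, (∀ n, a - b * ∑ i ∈ Finset.range n, (q i : R) * t ^ i ∈ J ^ n) → b = 0)
    (j : ℕ) : ∀ a b, (∀ n, a - b * ∑ i ∈ Finset.range n, (q i : R) * t ^ i ∈ J ^ n ⊔ I ^ j) →
      b ∈ I ^ j := by
  have hσ : ∀ n, N.retr (∑ i ∈ Finset.range n, (q i : R) * t ^ i)
      = ∑ i ∈ Finset.range n, (q i : R) * t ^ i := by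
    intro n; simp [map_sum, map_mul, map_pow, ht]
  induction j with
  | zero => simp
  | succ j ih =>
    intro a b hab
    refine N.mem_pow_succ_of_deriv_mem hu
      (N.mem_of_retr_eq_zero (hdiv (N.retr a) _ fun n => ?_)) fun i =>
      ih (N.deriv i a) _ fun n => ?_
    · have := N.retr_mem_of_mem_sup hJ (hab n)
      rwa [map_sub, map_mul, hσ] at this
    · have h1 := N.deriv_mem_sup J (hab (n + 1)) i
      rw [map_sub, Derivation.leibniz, ← hσ, N.deriv_retr, hσ, smul_zero, zero_add, smul_eq_mul,
        Finset.sum_range_succ] at h1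
      have h2 : N.deriv i b * (q n * t ^ n) ∈ J ^ n ⊔ I ^ j :=
        Ideal.mem_sup_left (Ideal.mul_mem_left _ _ (Ideal.mul_mem_left _ _
          (Ideal.pow_mem_pow htJ n)))
      convert add_mem h1 h2 using 1
      ring

end NormalCoordinates

/-- Two ring homomorphisms modulo `K` which respect the ideal `J` and agree on a set of "constants"
representing `R / J` and on generators of `J` agree, if `K` is `J`-adically closed. -/
theorem RingHom.eq_of_eq_on_generators {R : Type*} [CommRing R] {J K : Ideal R} {ι : Type*}
    (u : ι → R) (hJ : J = Ideal.span (Set.range u)) (hK : ∀ a, (∀ n, a ∈ J ^ n ⊔ K) → a ∈ K)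
    (σ τ : R →+* R ⧸ K) (hσ : ∀ a ∈ J, σ a ∈ J.map (Ideal.Quotient.mk K))
    (hτ : ∀ a ∈ J, τ a ∈ J.map (Ideal.Quotient.mk K)) (hu : ∀ i, σ (u i) = τ (u i))
    (hc : ∀ a, ∃ c, σ c = τ c ∧ a - c ∈ J) : σ = τ := by
  -- every element of `J ^ n` is approximated modulo `J ^ (n + 1)` by one where `σ` and `τ` agree
  have h1 : ∀ a ∈ J, ∃ c ∈ J, σ c = τ c ∧ a - c ∈ J ^ 2 := by
    intro a ha
    have ha' : a ∈ Ideal.span (Set.range u) := hJ ▸ ha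
    refine Submodule.span_induction ?_ ?_ ?_ ?_ ha'
    · rintro _ ⟨i, rfl⟩
      exact ⟨u i, hJ ▸ Ideal.subset_span ⟨i, rfl⟩, hu i, by simp⟩
    · exact ⟨0, zero_mem _, by simp, by simp⟩
    · rintro x y _ _ ⟨c, hc1, hc2, hc3⟩ ⟨e, he1, he2, he3⟩
      exact ⟨c + e, add_mem hc1 he1, by simp [hc2, he2], by
        rw [add_sub_add_comm]; exact add_mem hc3 he3⟩
    · rintro r x hx ⟨c, hc1, hc2, hc3⟩
      obtain ⟨s, hs1, hs2⟩ := hc r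
      refine ⟨s * c, Ideal.mul_mem_left _ _ hc1, by simp [hc2, hs1], ?_⟩
      have : r • x - s * c = r * (x - c) + (r - s) * c := by simp only [smul_eq_mul]; ring
      rw [this]
      refine add_mem (Ideal.mul_mem_left _ _ hc3) ?_
      rw [pow_two]
      exact Ideal.mul_mem_mul hs2 hc1
  have h2 : ∀ n, ∀ a ∈ J ^ n, ∃ c ∈ J ^ n, σ c = τ c ∧ a - c ∈ J ^ (n + 1) := by
    intro n
    induction n with
    | zero =>
      intro a _
      obtain ⟨c, hc1, hc2⟩ := hc a
      exact ⟨c, by simp, hc1, by simpa using hc2⟩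
    | succ n ih =>
      intro a ha
      rw [pow_succ'] at ha
      refine Submodule.mul_induction_on ha ?_ ?_
      · intro x hx y hy
        obtain ⟨c, hc1, hc2, hc3⟩ := h1 x hx
        obtain ⟨e, he1, he2, he3⟩ := ih y hy
        refine ⟨c * e, by rw [pow_succ']; exact Ideal.mul_mem_mul hc1 he1, by simp [hc2, he2], ?_⟩
        have : x * y - c * e = x * (y - e) + (x - c) * e := by ring
        rw [this]
        refine add_mem ?_ ?_
        · rw [pow_succ' J (n + 1)]; exact Ideal.mul_mem_mul hx he3
        · rw [show n + 1 + 1 = 2 + n by ring, pow_add]; exact Ideal.mul_mem_mul hc3 he1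
      · rintro x y ⟨c, hc1, hc2, hc3⟩ ⟨e, he1, he2, he3⟩
        exact ⟨c + e, add_mem hc1 he1, by simp [hc2, he2], by
          rw [add_sub_add_comm]; exact add_mem hc3 he3⟩
  have h3 : ∀ n a, ∃ c, σ c = τ c ∧ a - c ∈ J ^ n := by
    intro n a
    induction n with
    | zero => exact ⟨0, by simp, by simp⟩
    | succ n ih =>
      obtain ⟨c, hc1, hc2⟩ := ih
      obtain ⟨e, -, he2, he3⟩ := h2 n _ hc2
      exact ⟨c + e, by simp [hc1, he2], by rwa [← sub_sub]⟩
  ext a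
  obtain ⟨b, hb⟩ := Ideal.Quotient.mk_surjective (σ a - τ a)
  rw [← sub_eq_zero, ← hb, Ideal.Quotient.eq_zero_iff_mem]
  refine hK b fun n => ?_
  rw [← Ideal.mem_quotient_iff_mem_sup, hb, Ideal.map_pow]
  obtain ⟨c, hc1, hc2⟩ := h3 n a
  have : σ a - τ a = σ (a - c) - τ (a - c) := by simp [hc1]
  rw [this]
  have key : ∀ φ : R →+* R ⧸ K, (∀ a ∈ J, φ a ∈ J.map (Ideal.Quotient.mk K)) →
      φ (a - c) ∈ J.map (Ideal.Quotient.mk K) ^ n := by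
    intro φ hφ
    have h := Ideal.mem_map_of_mem φ hc2
    rw [Ideal.map_pow] at h
    exact Ideal.pow_right_mono (Ideal.map_le_iff_le_comap.2 hφ) n h
  exact sub_mem (key σ hσ) (key τ hτ)

/-! ### Divided differences of analytic functions -/

section DividedDifference

variable {𝕜 E F : Type*} [NontriviallyNormedField 𝕜] [NormedAddCommGroup E] [NormedSpace 𝕜 E]
  [NormedAddCommGroup F] [NormedSpace 𝕜 F]

/-- The multilinear map with diagonal values `e ↦ p (w, …, w, e, v, …, v)`, with `e` in slot `i`. -/
noncomputable def ContinuousMultilinearMap.mixedSlot {n : ℕ} (p : E [×(n + 1)]→L[𝕜] F)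
    (i : Fin (n + 1)) : (E × E) [×n]→L[𝕜] (E →L[𝕜] F) :=
  ((p.domDomCongr (Equiv.swap i (Fin.last n))).curryRight).compContinuousLinearMap fun j =>
    if Equiv.swap i (Fin.last n) j.castSucc < i then ContinuousLinearMap.snd 𝕜 E E
    else ContinuousLinearMap.fst 𝕜 E E

theorem ContinuousMultilinearMap.mixedSlot_apply {n : ℕ} (p : E [×(n + 1)]→L[𝕜] F)
    (i : Fin (n + 1)) (v w e : E) :
    p.mixedSlot i (fun _ => (v, w)) e
      = p (Function.update (fun a => if a < i then w else v) i e) := by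
  rw [mixedSlot, compContinuousLinearMap_apply, curryRight_apply, domDomCongr_apply]
  congr 1
  funext a
  by_cases ha : a = i
  · subst ha; simp
  · rw [Function.update_of_ne ha]
    obtain ⟨j, hj⟩ : ∃ j : Fin n, Equiv.swap i (Fin.last n) a = j.castSucc := by
      have : Equiv.swap i (Fin.last n) a ≠ Fin.last n := by
        intro h
        apply ha
        rw [Equiv.swap_apply_eq_iff] at h
        simpa using h
      exact ⟨_, (Fin.castSucc_castPred _ this).symm⟩
    rw [hj, Fin.snoc_castSucc, ← hj, Equiv.swap_apply_self]
    split_ifs <;> rfl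

theorem ContinuousMultilinearMap.norm_mixedSlot_le {n : ℕ} (p : E [×(n + 1)]→L[𝕜] F)
    (i : Fin (n + 1)) : ‖p.mixedSlot i‖ ≤ ‖p‖ := by
  refine (norm_compContinuousLinearMap_le _ _).trans ?_
  rw [ContinuousMultilinearMap.curryRight_norm, norm_domDomCongr]
  refine mul_le_of_le_one_right (norm_nonneg _) (Finset.prod_le_one (fun _ _ => norm_nonneg _) ?_)
  intro j _
  split_ifs
  · exact ContinuousLinearMap.norm_snd_le 𝕜 E E
  · exact ContinuousLinearMap.norm_fst_le 𝕜 E E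

theorem ContinuousMultilinearMap.sum_mixedSlot_apply {n : ℕ} (p : E [×(n + 1)]→L[𝕜] F) (v w : E) :
    (∑ i, p.mixedSlot i) (fun _ => (v, w)) (v - w) = p (fun _ => v) - p (fun _ => w) := by
  have h : ∀ i : Fin (n + 1), p.mixedSlot i (fun _ => (v, w)) (v - w)
      = p (fun a => if (a : ℕ) < i then w else v)
        - p (fun a => if (a : ℕ) < (i : ℕ) + 1 then w else v) := by
    intro i
    rw [mixedSlot_apply, map_update_sub]
    congr 2
    · funext a
      by_cases ha : a = i
      · subst ha; simp
      · simp [Function.update_of_ne ha]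
    · funext a
      by_cases ha : a = i
      · subst ha; simp
      · have : (a : ℕ) ≠ i := fun h => ha (Fin.ext h)
        rw [Function.update_of_ne ha]
        simp only [Fin.lt_def]
        congr 1
        rw [eq_iff_iff]
        omega
  rw [_root_.sum_apply, _root_.sum_apply]
  simp only [h]
  rw [Fin.sum_univ_eq_sum_range (fun i => p (fun a : Fin (n + 1) => if (a : ℕ) < i then w else v)
    - p (fun a : Fin (n + 1) => if (a : ℕ) < i + 1 then w else v)), Finset.sum_range_sub']
  congr 2
  funext a
  simp [a.2]

/-- The power series of the divided difference of a function with power series `p`. -/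
noncomputable def FormalMultilinearSeries.dividedDifference (p : FormalMultilinearSeries 𝕜 E F) :
    FormalMultilinearSeries 𝕜 (E × E) (E →L[𝕜] F) :=
  fun n => ∑ i, (p (n + 1)).mixedSlot i

theorem FormalMultilinearSeries.radius_dividedDifference_pos {p : FormalMultilinearSeries 𝕜 E F}
    (hp : 0 < p.radius) : 0 < p.dividedDifference.radius := by
  obtain ⟨r, hr0, hr⟩ := ENNReal.lt_iff_exists_nnreal_btwn.1 hp
  replace hr0 : (0 : ℝ) < r := by exact_mod_cast hr0
  obtain ⟨C, hC, hCp⟩ := p.norm_mul_pow_le_of_lt_radius hr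
  refine lt_of_lt_of_le ?_ (p.dividedDifference.le_radius_of_bound (r := r / 2) (C / r)
    fun n => ?_)
  · rw [ENNReal.coe_pos]; exact half_pos (by exact_mod_cast hr0)
  have h1 : ‖p.dividedDifference n‖ ≤ (n + 1) * ‖p (n + 1)‖ := by
    refine (norm_sum_le Finset.univ fun i => (p (n + 1)).mixedSlot i).trans ?_
    refine (Finset.sum_le_sum fun i _ => (p (n + 1)).norm_mixedSlot_le i).trans ?_
    simp
  have h2 : ((n : ℝ) + 1) ≤ 2 ^ n := by exact_mod_cast Nat.lt_two_pow_self
  have h3 := hCp (n + 1)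
  rw [NNReal.coe_div, NNReal.coe_two, div_pow, ← mul_div_assoc, div_le_div_iff₀ (by positivity) hr0]
  calc ‖p.dividedDifference n‖ * r ^ n * r
      ≤ ((n + 1) * ‖p (n + 1)‖) * r ^ n * r := by gcongr
    _ = (n + 1) * (‖p (n + 1)‖ * r ^ (n + 1)) := by ring
    _ ≤ 2 ^ n * C := by gcongr
    _ = C * 2 ^ n := mul_comm _ _

/-- An analytic function has analytic divided differences: near `(a, a)`,
`f v - f w = G (v, w) (v - w)` for an analytic `G`. -/
theorem AnalyticAt.exists_dividedDifference [CompleteSpace F] {f : E → F} {a : E}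
    (hf : AnalyticAt 𝕜 f a) : ∃ G : E × E → E →L[𝕜] F, AnalyticAt 𝕜 G (a, a) ∧
      ∀ᶠ x in 𝓝 (a, a), f x.1 - f x.2 = G x (x.1 - x.2) := by
  obtain ⟨p, r, hp⟩ := hf
  have hpos := p.radius_dividedDifference_pos (hp.r_pos.trans_le hp.r_le)
  have hG := p.dividedDifference.hasFPowerSeriesOnBall hpos
  refine ⟨fun x => p.dividedDifference.sum (x - (a, a)), ?_, ?_⟩
  · have := hG.comp_sub (a, a)
    rw [zero_add] at this
    exact this.analyticAt
  have e1 : ∀ᶠ x : E × E in 𝓝 (a, a),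
      x - (a, a) ∈ Metric.eball (0 : E × E) p.dividedDifference.radius := by
    have : Tendsto (fun x : E × E => x - (a, a)) (𝓝 (a, a)) (𝓝 0) := by
      have h : Continuous (fun x : E × E => x - (a, a)) := by fun_prop
      simpa using h.tendsto (a, a)
    exact this (Metric.eball_mem_nhds _ hpos)
  have e2 : ∀ᶠ x : E × E in 𝓝 (a, a), x.1 ∈ Metric.eball a r :=
    continuous_fst.continuousAt (x := (a, a)) (Metric.eball_mem_nhds _ hp.r_pos)
  have e3 : ∀ᶠ x : E × E in 𝓝 (a, a), x.2 ∈ Metric.eball a r :=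
    continuous_snd.continuousAt (x := (a, a)) (Metric.eball_mem_nhds _ hp.r_pos)
  filter_upwards [e1, e2, e3] with ⟨v, w⟩ h1 h2 h3
  have s1 := hp.hasSum_sub h2
  have s2 := hp.hasSum_sub h3
  have s3 := (hG.hasSum h1).mapL (ContinuousLinearMap.apply 𝕜 F (v - w))
  have s4 := (hasSum_nat_add_iff' 1).2 (s1.sub s2)
  simp only [Finset.range_one, Finset.sum_singleton] at s4
  have e0 : (p 0 fun _ : Fin 0 => v - a) = p 0 fun _ => w - a := by congr 1; funext i; exact i.elim0
  rw [e0, sub_self, sub_zero] at s4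
  refine s4.unique ?_
  convert s3 using 1
  · funext n
    have := (p (n + 1)).sum_mixedSlot_apply (v - a) (w - a)
    rw [sub_sub_sub_cancel_right] at this
    exact this.symm
  · simp

end DividedDifference

/-! ### Flat functions, divergent products and bounded power series -/

theorem exists_norm_iteratedDeriv_le {u : ℂ → ℂ} (hu : AnalyticAt ℂ u 0) :
    ∃ C R : ℝ, 0 < R ∧ ∀ n : ℕ, ‖iteratedDeriv n u 0‖ ≤ n.factorial * C / R ^ n := by
  obtain ⟨r, hr, hr'⟩ := Metric.eventually_nhds_iff.1 hu.eventually_analyticAt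
  have hsub : ∀ y ∈ Metric.closedBall (0 : ℂ) (r / 2), AnalyticAt ℂ u y := fun y hy =>
    hr' (lt_of_le_of_lt (Metric.mem_closedBall.1 hy) (half_lt_self hr))
  have hc : ContinuousOn u (Metric.closedBall 0 (r / 2)) := fun y hy =>
    (hsub y hy).continuousAt.continuousWithinAt
  obtain ⟨C, hC⟩ := (isCompact_closedBall (0 : ℂ) (r / 2)).exists_bound_of_continuousOn hc
  refine ⟨C, r / 2, half_pos hr, fun n => ?_⟩
  refine Complex.norm_iteratedDeriv_le_of_forall_mem_sphere_norm_le n (half_pos hr) ?_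
    fun z hz => hC z (Metric.sphere_subset_closedBall hz)
  refine DifferentiableOn.diffContOnCl_ball (U := Metric.closedBall 0 (r / 2)) ?_ subset_rfl
  exact fun y hy => (hsub y hy).differentiableAt.differentiableWithinAt

/-- No convergent power series is congruent to `∑ i! (w s)^i` to all orders. -/
theorem not_forall_le_analyticOrderAt_sub_factorial {u : ℂ → ℂ} (hu : AnalyticAt ℂ u 0) {w : ℂ}
    (hw : w ≠ 0) : ¬ ∀ n : ℕ, (n : ℕ∞) ≤ analyticOrderAt
      (fun s => u s - ∑ i ∈ Finset.range n, (i.factorial : ℂ) * (w * s) ^ i) 0 := by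
  intro h
  have key : ∀ n : ℕ, iteratedDeriv n u 0 = n.factorial * w ^ n * n.factorial := by
    intro n
    have h1 := h (n + 1)
    have ha : AnalyticAt ℂ
        (fun s => ∑ i ∈ Finset.range (n + 1), (i.factorial : ℂ) * (w * s) ^ i) 0 :=
      Finset.analyticAt_fun_sum _ fun i _ => by fun_prop
    rw [natCast_le_analyticOrderAt_iff_iteratedDeriv_eq_zero (hu.fun_sub ha)] at h1
    have h2 := h1 n (Nat.lt_succ_self n)
    rw [iteratedDeriv_fun_sub hu.contDiffAt ha.contDiffAt, sub_eq_zero] at h2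
    rw [h2, iteratedDeriv_fun_sum (fun i _ => by fun_prop)]
    simp only [mul_pow, ← mul_assoc]
    simp only [iteratedDeriv_const_mul_field, iteratedDeriv_fun_pow_zero]
    simp
  obtain ⟨C, R, hR, hC⟩ := exists_norm_iteratedDeriv_le hu
  have hb : ∀ n : ℕ, (n.factorial : ℝ) * (‖w‖ * R) ^ n ≤ C := by
    intro n
    have h1 := hC n
    rw [key, norm_mul, norm_mul, norm_pow, Complex.norm_natCast, le_div_iff₀ (by positivity)] at h1
    have h2 : (0 : ℝ) < n.factorial := by positivity
    refine le_of_mul_le_mul_left ?_ h2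
    calc (n.factorial : ℝ) * (n.factorial * (‖w‖ * R) ^ n)
        = n.factorial * ‖w‖ ^ n * n.factorial * R ^ n := by rw [mul_pow]; ring
      _ ≤ n.factorial * C := h1
  have hwR : 0 < ‖w‖ * R := mul_pos (norm_pos_iff.2 hw) hR
  have hC0 : 0 < C := lt_of_lt_of_le (by simp) (hb 0)
  have hlim := FloorSemiring.tendsto_pow_div_factorial_atTop (‖w‖ * R)⁻¹
  obtain ⟨n, hn⟩ := (hlim.eventually_lt_const (inv_pos.2 hC0)).exists
  have h3 := hb n
  rw [inv_pow, div_eq_mul_inv, ← mul_inv, inv_lt_inv₀ (by positivity) hC0, mul_comm] at hn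
  exact absurd h3 (not_le.2 hn)

/-- If `B * ∑ i! (w s)^i` agrees to all orders with a convergent power series, then `B = 0`. -/
theorem eventually_eq_zero_of_mul_factorial {A B : ℂ → ℂ} (hA : AnalyticAt ℂ A 0)
    (hB : AnalyticAt ℂ B 0) {w : ℂ} (hw : w ≠ 0)
    (h : ∀ n : ℕ, (n : ℕ∞) ≤ analyticOrderAt
      (fun s => A s - B s * ∑ i ∈ Finset.range n, (i.factorial : ℂ) * (w * s) ^ i) 0) :
    ∀ᶠ s in 𝓝 0, B s = 0 := by
  have hσ : ∀ n : ℕ, AnalyticAt ℂ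
      (fun s => ∑ i ∈ Finset.range n, (i.factorial : ℂ) * (w * s) ^ i) 0 := fun n =>
    Finset.analyticAt_fun_sum _ fun i _ => by fun_prop
  rcases hB.eventually_eq_zero_or_eventually_ne_zero with h0 | h0
  · exact h0
  exfalso
  have hfin : ∃ n : ℕ, ∃ g : ℂ → ℂ, AnalyticAt ℂ g 0 ∧ g 0 ≠ 0 ∧
      ∀ᶠ z in 𝓝 0, B z = (z - 0) ^ n • g z := by
    rw [hB.exists_eventuallyEq_pow_smul_nonzero_iff]
    intro h1
    obtain ⟨s, hs1, hs2⟩ := (h0.and (h1.filter_mono nhdsWithin_le_nhds)).exists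
    exact hs1 hs2
  obtain ⟨e, b, hb, hb0, hBb⟩ := hfin
  -- `A` is divisible by `s ^ e` as well, so that `B` may be divided out
  have hdiv : ∀ n : ℕ, ∃ g : ℂ → ℂ, AnalyticAt ℂ g 0 ∧ ∀ᶠ s in 𝓝 0, A s =
      s ^ e * (b s * ∑ i ∈ Finset.range (n + e), (i.factorial : ℂ) * (w * s) ^ i + s ^ n * g s) := by
    intro n
    obtain ⟨g, hg, hgs⟩ := (natCast_le_analyticOrderAt
      (hA.fun_sub (hB.fun_mul (hσ (n + e))))).1 (h (n + e))
    refine ⟨g, hg, ?_⟩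
    filter_upwards [hgs, hBb] with s h1 h2
    simp only [sub_zero, smul_eq_mul] at h1 h2
    rw [h2] at h1
    rw [pow_add] at h1
    linear_combination h1
  obtain ⟨g₀, hg₀, hA₀⟩ := hdiv 0
  set a : ℂ → ℂ := fun s =>
    b s * ∑ i ∈ Finset.range (0 + e), (i.factorial : ℂ) * (w * s) ^ i + s ^ 0 * g₀ s with ha
  have haa : AnalyticAt ℂ a 0 := (hb.fun_mul (hσ _)).fun_add (by fun_prop)
  have hAa : ∀ᶠ s in 𝓝 0, A s = s ^ e * a s := hA₀
  have hub : AnalyticAt ℂ (fun s => a s / b s) 0 := haa.fun_div hb hb0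
  refine not_forall_le_analyticOrderAt_sub_factorial hub hw fun n => ?_
  rw [natCast_le_analyticOrderAt (hub.fun_sub (hσ n))]
  obtain ⟨g, hg, hgs⟩ := hdiv n
  have hq : AnalyticAt ℂ (fun s => g s / b s
      + ∑ i ∈ Finset.range e, ((n + i).factorial : ℂ) * w ^ n * (w * s) ^ i) 0 := by
    refine (hg.fun_div hb hb0).fun_add (Finset.analyticAt_fun_sum _ fun i _ => by fun_prop)
  refine ⟨_, hq, ?_⟩
  have heq : ∀ᶠ s in 𝓝[≠] (0 : ℂ), (a s / b s
        - ∑ i ∈ Finset.range n, (i.factorial : ℂ) * (w * s) ^ i)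
      = (s - 0) ^ n • (g s / b s
        + ∑ i ∈ Finset.range e, ((n + i).factorial : ℂ) * w ^ n * (w * s) ^ i) := by
    filter_upwards [hgs.filter_mono nhdsWithin_le_nhds, hAa.filter_mono nhdsWithin_le_nhds,
      (hb.continuousAt.eventually_ne hb0).filter_mono nhdsWithin_le_nhds,
      self_mem_nhdsWithin] with s h1 h2 h3 h4
    replace h4 : s ≠ 0 := h4
    rw [h2] at h1
    have h5 := mul_left_cancel₀ (pow_ne_zero e h4) h1
    rw [h5, Finset.sum_range_add, sub_zero, smul_eq_mul]
    have h6 : ∑ x ∈ Finset.range e, ((n + x).factorial : ℂ) * (w * s) ^ (n + x)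
        = s ^ n * ∑ i ∈ Finset.range e, ((n + i).factorial : ℂ) * w ^ n * (w * s) ^ i := by
      rw [Finset.mul_sum]
      exact Finset.sum_congr rfl fun i _ => by rw [pow_add, mul_pow w s n]; ring
    rw [h6]
    have h7 : ∀ S T : ℂ, (b s * (S + s ^ n * T) + s ^ n * g s) / b s - S
        = s ^ n * (g s / b s + T) := by
      intro S T; field_simp; ring
    exact h7 _ _
  exact ((hub.fun_sub (hσ n)).frequently_eq_iff_eventually_eq
    (((analyticAt_id.fun_sub analyticAt_const).fun_pow n).fun_smul hq)).1 heq.frequently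

/-- An analytic function vanishes if its germs along a dense set of lines do. -/
theorem AnalyticAt.eventually_eq_zero_of_lines {E : Type*} [NormedAddCommGroup E] [NormedSpace ℂ E]
    {f : E → ℂ} {a : E} (hf : AnalyticAt ℂ f a) {P : Set E} (hP : Dense P)
    (h : ∀ v ∈ P, ∀ᶠ s : ℂ in 𝓝 0, f (a + s • v) = 0) : ∀ᶠ y in 𝓝 a, f y = 0 := by
  obtain ⟨r, hr, hr'⟩ := Metric.eventually_nhds_iff_ball.1 hf.eventually_analyticAt
  have hline : ∀ v ∈ P, v ∈ Metric.ball (0 : E) r → f (a + v) = 0 := by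
    intro v hv hvr
    set L : ℂ → E := fun s => a + s • v with hL
    have hLa : ∀ s, AnalyticAt ℂ L s := fun s =>
      analyticAt_const.fun_add (analyticAt_id.fun_smul analyticAt_const)
    have hU : Convex ℝ (L ⁻¹' Metric.ball a r) := by
      have : L = (fun y => a + y) ∘ ((LinearMap.toSpanSingleton ℂ E v).restrictScalars ℝ) := rfl
      rw [this, Set.preimage_comp]
      exact ((convex_ball a r).translate_preimage_right a).linear_preimage _
    have hfL : AnalyticOnNhd ℂ (f ∘ L) (L ⁻¹' Metric.ball a r) := fun s hs =>
      (hr' _ hs).comp (hLa s)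
    have h0 : (0 : ℂ) ∈ L ⁻¹' Metric.ball a r := by simp [hL, hr]
    have h1 : (1 : ℂ) ∈ L ⁻¹' Metric.ball a r := by
      simpa [hL, mem_ball_iff_norm] using hvr
    have := hfL.eqOn_zero_of_preconnected_of_eventuallyEq_zero hU.isPreconnected h0 (h v hv) h1
    simpa [hL] using this
  filter_upwards [Metric.ball_mem_nhds a hr] with y hy
  by_contra hne
  have hc : ContinuousAt (fun v => f (a + v)) (y - a) := by
    have : ContinuousAt f (a + (y - a)) := by
      rw [add_sub_cancel]; exact (hr' y hy).continuousAt
    exact this.comp (by fun_prop)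
  have hne' : ∀ᶠ v in 𝓝 (y - a), f (a + v) ≠ 0 := hc.eventually_ne (by simpa using hne)
  have hball : ∀ᶠ v in 𝓝 (y - a), v ∈ Metric.ball (0 : E) r :=
    Metric.isOpen_ball.mem_nhds (by simpa [mem_ball_iff_norm, dist_eq_norm] using hy)
  obtain ⟨v, hvP, hv1, hv2⟩ :=
    ((mem_closure_iff_frequently.1 (hP (y - a))).and_eventually (hne'.and hball)).exists
  exact hv1 (hline v hvP hv2)

theorem dense_setOf_apply_ne_zero {n : ℕ} (i : Fin n) : Dense {v : Fin n → ℂ | v i ≠ 0} :=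
  (dense_compl_singleton (0 : ℂ)).preimage (isOpenMap_eval i)

theorem analyticAt_tsum_of_bounded {a : ℕ → ℂ} (ha : ∀ n, ‖a n‖ ≤ 1) :
    AnalyticAt ℂ (fun s => ∑' n, a n * s ^ n) 0 := by
  set p := FormalMultilinearSeries.ofScalars ℂ a
  have hp : (1 : ENNReal) ≤ p.radius := by
    have := p.le_radius_of_bound (r := 1) 1 fun n => by
      simpa [p, FormalMultilinearSeries.ofScalars_norm] using ha n
    simpa using this
  have h := (p.hasFPowerSeriesOnBall (zero_lt_one.trans_le hp)).analyticAt
  have h2 : p.sum = fun s => ∑' n, a n * s ^ n := by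
    have := FormalMultilinearSeries.ofScalarsSum_eq_tsum (𝕜 := ℂ) (E := ℂ) a
    simpa [FormalMultilinearSeries.ofScalarsSum] using this
  rwa [h2] at h

theorem tsum_eq_sum_range_add_pow_mul {a : ℕ → ℂ} (ha : ∀ n, ‖a n‖ ≤ 1) {s : ℂ} (hs : ‖s‖ < 1)
    (N : ℕ) : ∑' n, a n * s ^ n
      = ∑ i ∈ Finset.range N, a i * s ^ i + s ^ N * ∑' n, a (n + N) * s ^ n := by
  have hsum : Summable fun n => a n * s ^ n := by
    refine Summable.of_norm_bounded (summable_geometric_of_lt_one (norm_nonneg s) hs) fun n => ?_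
    rw [norm_mul, norm_pow]
    exact mul_le_of_le_one_left (by positivity) (ha n)
  rw [← hsum.sum_add_tsum_nat_add N, ← tsum_mul_left]
  congr 1
  exact tsum_congr fun n => by rw [pow_add]; ring

/-! ### The Hadamard lemma -/

/-- `killNormal` as a continuous linear map. -/
noncomputable def killNormalL (m d : ℕ) : CSpace m d →L[ℂ] CSpace m d :=
  ContinuousLinearMap.pi fun i =>
    Fin.addCases (fun _ => 0) (fun p => ContinuousLinearMap.proj (Fin.natAdd m p)) i

theorem killNormalL_apply {m d : ℕ} (v : CSpace m d) : killNormalL m d v = killNormal v := by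
  funext i
  refine Fin.addCases (fun r => ?_) (fun p => ?_) i
  · simp [killNormalL, killNormal]
  · simp [killNormalL, killNormal]

@[simp] theorem killNormal_castAdd {m d : ℕ} (v : CSpace m d) (r : Fin m) :
    killNormal v (Fin.castAdd d r) = 0 := by simp [killNormal]

@[simp] theorem killNormal_natAdd {m d : ℕ} (v : CSpace m d) (p : Fin d) :
    killNormal v (Fin.natAdd m p) = v (Fin.natAdd m p) := by simp [killNormal]

theorem killNormal_eq_self_iff {m d : ℕ} {v : CSpace m d} :
    killNormal v = v ↔ ∀ r : Fin m, v (Fin.castAdd d r) = 0 := by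
  constructor
  · intro h r; rw [← h]; simp
  · intro h; funext i
    refine Fin.addCases (fun r => ?_) (fun p => ?_) i <;> simp [h]

@[simp] theorem killNormal_killNormal {m d : ℕ} (v : CSpace m d) :
    killNormal (killNormal v) = killNormal v :=
  killNormal_eq_self_iff.2 (by simp)

theorem continuous_killNormal {m d : ℕ} : Continuous (killNormal (m := m) (d := d)) :=
  (killNormalL m d).continuous.congr killNormalL_apply

theorem analyticAt_killNormal {m d : ℕ} (v : CSpace m d) : AnalyticAt ℂ killNormal v := by
  have h := (killNormalL m d).analyticAt v
  rwa [show ⇑(killNormalL m d) = killNormal from funext killNormalL_apply] at h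

theorem ContinuousLinearMap.apply_eq_sum_single {n : ℕ} (A : (Fin n → ℂ) →L[ℂ] ℂ) (u : Fin n → ℂ) :
    A u = ∑ i, u i * A (Pi.single i 1) := by
  conv_lhs => rw [pi_eq_sum_univ' u]
  simp [map_sum]

theorem AnalyticAt.exists_sub_apply_eq_sum {n : ℕ} {F : (Fin n → ℂ) → ℂ} {v₀ : Fin n → ℂ}
    (hF : AnalyticAt ℂ F v₀) : ∃ h : Fin n → (Fin n → ℂ) → ℂ, (∀ i, AnalyticAt ℂ (h i) v₀) ∧
      ∀ᶠ v in 𝓝 v₀, F v - F v₀ = ∑ i, (v i - v₀ i) * h i v := by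
  obtain ⟨G, hG, hGF⟩ := hF.exists_dividedDifference
  have hι : AnalyticAt ℂ (fun v : Fin n → ℂ => (v, v₀)) v₀ := analyticAt_id.prod analyticAt_const
  refine ⟨fun i v => G (v, v₀) (Pi.single i 1), fun i => ?_, ?_⟩
  · have h1 : AnalyticAt ℂ (fun v => G (v, v₀)) v₀ := hG.comp_of_eq hι rfl
    exact ((ContinuousLinearMap.apply ℂ ℂ (Pi.single i 1 : Fin n → ℂ)).analyticAt _).comp h1
  · have := hι.continuousAt.eventually hGF
    filter_upwards [this] with v hv
    rw [hv, ContinuousLinearMap.apply_eq_sum_single]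
    rfl

/-- Hadamard's lemma: `F(z', z'') - F(0, z'')` is a combination of the coordinates `z'` with
analytic coefficients. -/
theorem AnalyticAt.exists_sub_killNormal_eq_sum {m d : ℕ} {F : CSpace m d → ℂ} {v₀ : CSpace m d}
    (hF : AnalyticAt ℂ F v₀) (hv₀ : killNormal v₀ = v₀) :
    ∃ h : Fin m → CSpace m d → ℂ, (∀ r, AnalyticAt ℂ (h r) v₀) ∧
      ∀ᶠ v in 𝓝 v₀, F v - F (killNormal v) = ∑ r, v (Fin.castAdd d r) * h r v := by
  obtain ⟨G, hG, hGF⟩ := hF.exists_dividedDifference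
  have hι : AnalyticAt ℂ (fun v : CSpace m d => (v, killNormal v)) v₀ :=
    analyticAt_id.prod (analyticAt_killNormal v₀)
  have hι0 : (v₀, killNormal v₀) = (v₀, v₀) := by rw [hv₀]
  refine ⟨fun r v => G (v, killNormal v) (Pi.single (Fin.castAdd d r) 1), fun r => ?_, ?_⟩
  · have h1 : AnalyticAt ℂ (fun v => G (v, killNormal v)) v₀ := hG.comp_of_eq hι hι0
    exact ((ContinuousLinearMap.apply ℂ ℂ
      (Pi.single (Fin.castAdd d r) 1 : CSpace m d)).analyticAt _).comp h1
  · have h2 : Tendsto (fun v : CSpace m d => (v, killNormal v)) (𝓝 v₀) (𝓝 (v₀, v₀)) := by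
      have := hι.continuousAt.tendsto; rwa [hι0] at this
    filter_upwards [h2.eventually hGF] with v hv
    rw [hv, ContinuousLinearMap.apply_eq_sum_single, Fin.sum_univ_add]
    simp

/-! ### Stalks of holomorphic functions -/

theorem contDiffAt_omega_iff_analyticAt_complex {E F : Type*} [NormedAddCommGroup E]
    [NormedSpace ℂ E] [NormedAddCommGroup F] [NormedSpace ℂ F] [CompleteSpace F] {f : E → F} {x : E} :
    ContDiffAt ℂ ω f x ↔ AnalyticAt ℂ f x := by
  rw [← contDiffWithinAt_univ, contDiffWithinAt_omega_iff_analyticWithinAt, analyticWithinAt_univ]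

section Chart

variable {m d : ℕ} {M : Type*} [TopologicalSpace M] {z : OpenPartialHomeomorph M (CSpace m d)}
  {x : M}

theorem eventually_symm_apply (hx : x ∈ z.source) : ∀ᶠ y in 𝓝 x, z.symm (z y) = y := by
  filter_upwards [z.open_source.mem_nhds hx] with y hy using z.left_inv hy

theorem eventually_chart_iff (hx : x ∈ z.source) {P : CSpace m d → Prop} :
    (∀ᶠ y in 𝓝 x, P (z y)) ↔ ∀ᶠ v in 𝓝 (z x), P v := by
  rw [← z.map_nhds_eq hx, eventually_map]

theorem mem_iff_killNormal_eq {S : Set M} (hzS : z.source ∩ S = normalZeros z) {y : M}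
    (hy : y ∈ z.source) :
    y ∈ S ↔ killNormal (z y) = z y := by
  rw [killNormal_eq_self_iff]
  have : y ∈ z.source ∩ S ↔ y ∈ normalZeros z := by rw [hzS]
  exact ⟨fun h => (this.1 ⟨hy, h⟩).2, fun h => (this.2 ⟨hy, h⟩).2⟩

end Chart

section Stalk

variable {m d : ℕ} {M : Type*} [TopologicalSpace M] [ChartedSpace (CSpace m d) M]

theorem exists_holGerm {x : M} (φ : holStalk m d x) :
    ∃ (f : M → ℂ) (hf : HolAt m d f x), φ = holGerm f x hf := by
  obtain ⟨φ, f, rfl, hf⟩ := φ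
  exact ⟨f, hf, rfl⟩

theorem holGerm_eq_iff {x : M} {f g : M → ℂ} {hf : HolAt m d f x} {hg : HolAt m d g x} :
    holGerm f x hf = holGerm g x hg ↔ f =ᶠ[𝓝 x] g := by
  exact Subtype.ext_iff.trans Germ.coe_eq

theorem HolAt.congr {x : M} {f g : M → ℂ} (hf : HolAt m d f x) (h : g =ᶠ[𝓝 x] f) :
    HolAt m d g x :=
  ContMDiffAt.congr_of_eventuallyEq hf h

theorem HolAt.const {x : M} (c : ℂ) : HolAt m d (fun _ => c) x := contMDiffAt_const

theorem HolAt.add {x : M} {f g : M → ℂ} (hf : HolAt m d f x) (hg : HolAt m d g x) :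
    HolAt m d (fun y => f y + g y) x :=
  ContMDiffAt.add hf hg

theorem HolAt.mul {x : M} {f g : M → ℂ} (hf : HolAt m d f x) (hg : HolAt m d g x) :
    HolAt m d (fun y => f y * g y) x :=
  ContMDiffAt.mul hf hg

theorem HolAt.sub {x : M} {f g : M → ℂ} (hf : HolAt m d f x) (hg : HolAt m d g x) :
    HolAt m d (fun y => f y - g y) x :=
  ContMDiffAt.sub hf hg

theorem HolAt.sum {x : M} {ι : Type*} {s : Finset ι} {f : ι → M → ℂ}
    (hf : ∀ i, HolAt m d (f i) x) : HolAt m d (fun y => ∑ i ∈ s, f i y) x := by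
  classical
  induction s using Finset.induction_on with
  | empty => simpa using HolAt.const 0
  | insert i s hi ih =>
    simp only [Finset.sum_insert hi]
    exact (hf i).add ih

theorem holGerm_sum {x : M} {ι : Type*} (s : Finset ι) {f : ι → M → ℂ}
    (hf : ∀ i, HolAt m d (f i) x) :
    holGerm (fun y => ∑ i ∈ s, f i y) x (HolAt.sum hf) = ∑ i ∈ s, holGerm (f i) x (hf i) := by
  apply Subtype.ext
  have h1 : ((∑ i ∈ s, holGerm (f i) x (hf i) : holStalk m d x) : Germ (𝓝 x) ℂ)
      = ∑ i ∈ s, Germ.coeRingHom (𝓝 x) (f i) := by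
    rw [AddSubmonoidClass.coe_finsetSum]; rfl
  rw [h1, ← map_sum]
  have : (fun y => ∑ i ∈ s, f i y) = ∑ i ∈ s, f i := by funext y; simp
  rw [holGerm]
  simp only [this]
  rfl

theorem holGerm_mul {x : M} {f g : M → ℂ} (hf : HolAt m d f x) (hg : HolAt m d g x) :
    holGerm (fun y => f y * g y) x (hf.mul hg) = holGerm f x hf * holGerm g x hg := rfl

theorem holGerm_add {x : M} {f g : M → ℂ} (hf : HolAt m d f x) (hg : HolAt m d g x) :
    holGerm (fun y => f y + g y) x (hf.add hg) = holGerm f x hf + holGerm g x hg := rfl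

theorem holGerm_sub {x : M} {f g : M → ℂ} (hf : HolAt m d f x) (hg : HolAt m d g x) :
    holGerm (fun y => f y - g y) x (hf.sub hg) = holGerm f x hf - holGerm g x hg := by
  rw [eq_sub_iff_add_eq, ← holGerm_add (hf.sub hg) hg, holGerm_eq_iff]
  exact Eventually.of_forall fun y => sub_add_cancel _ _

variable (m d) in
/-- The inclusion of the constants in the stalk. -/
noncomputable def constStalk (x : M) : ℂ →+* holStalk m d x where
  toFun c := holGerm (fun _ => c) x (HolAt.const c)
  map_one' := rfl
  map_zero' := rfl
  map_add' _ _ := rfl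
  map_mul' _ _ := rfl

theorem isUnit_natCast_holStalk (x : M) (n : ℕ) : IsUnit ((n + 1 : ℕ) : holStalk m d x) := by
  rw [← map_natCast (constStalk m d x)]
  exact (isUnit_iff_ne_zero.2 (Nat.cast_ne_zero.2 n.succ_ne_zero)).map _

variable (m d) in
/-- Evaluation of germs at the base point. -/
noncomputable def evalStalk (x : M) : holStalk m d x →+* ℂ :=
  (Germ.valueRingHom (X := M) (x := x)).comp (holStalk m d x).subtype

theorem evalStalk_constStalk (x : M) (c : ℂ) : evalStalk m d x (constStalk m d x c) = c := rfl

variable (m d) in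
/-- The ideal of germs vanishing at the base point. -/
noncomputable def vanishingIdeal (x : M) : Ideal (holStalk m d x) := RingHom.ker (evalStalk m d x)

theorem sub_constStalk_mem_vanishingIdeal {x : M} (φ : holStalk m d x) :
    φ - constStalk m d x (evalStalk m d x φ) ∈ vanishingIdeal m d x := by
  rw [vanishingIdeal, RingHom.mem_ker, map_sub, evalStalk_constStalk, sub_self]

theorem idealStalk_le_vanishingIdeal {S : Set M} {x : M} (hx : x ∈ S) :
    idealStalk m d S x ≤ vanishingIdeal m d x := by
  rintro φ ⟨f, hf, hf0⟩
  have h1 : evalStalk m d x φ = f x := by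
    change Germ.value (φ : Germ (𝓝 x) ℂ) = f x
    rw [hf]; rfl
  rw [vanishingIdeal, RingHom.mem_ker, h1]
  exact hf0.self_of_nhds hx

/-! ### Germs read in a chart -/

/-- `z` is a chart of the complex manifold `M`. -/
abbrev IsHolChart (z : OpenPartialHomeomorph M (CSpace m d)) : Prop :=
  z ∈ IsManifold.maximalAtlas 𝓘(ℂ, CSpace m d) ω M

variable {z : OpenPartialHomeomorph M (CSpace m d)} {x : M}

theorem holAt_comp_chart (hz : IsHolChart z) (hx : x ∈ z.source) {F : CSpace m d → ℂ}
    (hF : AnalyticAt ℂ F (z x)) : HolAt m d (fun y => F (z y)) x := by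
  have h1 : ContMDiffAt 𝓘(ℂ, CSpace m d) 𝓘(ℂ, ℂ) ω F (z x) :=
    (contDiffAt_omega_iff_analyticAt_complex.2 hF).contMDiffAt
  exact h1.comp x (contMDiffAt_of_mem_maximalAtlas hz hx)

theorem holAt_iff (hz : IsHolChart z) (hx : x ∈ z.source) {f : M → ℂ} :
    HolAt m d f x ↔ AnalyticAt ℂ (f ∘ z.symm) (z x) := by
  constructor
  · intro hf
    rw [← contDiffAt_omega_iff_analyticAt_complex, ← contMDiffAt_iff_contDiffAt]
    have h1 := contMDiffAt_symm_of_mem_maximalAtlas hz (z.map_source hx)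
    refine ContMDiffAt.comp (z x) ?_ h1
    rw [z.left_inv hx]
    exact hf
  · intro hf
    refine (holAt_comp_chart hz hx hf).congr ?_
    filter_upwards [eventually_symm_apply hx] with y hy
    simp [hy]

theorem HolAt.eventually [IsManifold 𝓘(ℂ, CSpace m d) ω M] {f : M → ℂ}
    (hf : HolAt m d f x) : ∀ᶠ y in 𝓝 x, HolAt m d f y := by
  have hz := IsManifold.chart_mem_maximalAtlas (I := 𝓘(ℂ, CSpace m d)) (n := ω) x
  have hx := mem_chart_source (CSpace m d) x
  rw [holAt_iff hz hx] at hf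
  have h1 := (eventually_chart_iff hx).2 hf.eventually_analyticAt
  filter_upwards [h1, (chartAt (CSpace m d) x).open_source.mem_nhds hx] with y hy hy'
  exact (holAt_iff hz hy').2 hy

/-- The germ of the function with expression `F` in the chart `z`. -/
noncomputable def chartGerm (hz : IsHolChart z) (hx : x ∈ z.source) (F : CSpace m d → ℂ)
    (hF : AnalyticAt ℂ F (z x)) : holStalk m d x :=
  holGerm (fun y => F (z y)) x (holAt_comp_chart hz hx hF)

theorem chartGerm_eq_iff (hz : IsHolChart z) (hx : x ∈ z.source) {F G : CSpace m d → ℂ}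
    {hF : AnalyticAt ℂ F (z x)} {hG : AnalyticAt ℂ G (z x)} :
    chartGerm hz hx F hF = chartGerm hz hx G hG ↔ F =ᶠ[𝓝 (z x)] G := by
  rw [chartGerm, chartGerm, holGerm_eq_iff]
  exact eventually_chart_iff hx (P := fun v => F v = G v)

theorem holGerm_eq_chartGerm (hz : IsHolChart z) (hx : x ∈ z.source) {f : M → ℂ}
    (hf : HolAt m d f x) :
    holGerm f x hf = chartGerm hz hx (f ∘ z.symm) ((holAt_iff hz hx).1 hf) := by
  rw [chartGerm, holGerm_eq_iff]
  filter_upwards [eventually_symm_apply hx] with y hy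
  simp [hy]

theorem exists_chartGerm (hz : IsHolChart z) (hx : x ∈ z.source) (φ : holStalk m d x) :
    ∃ (F : CSpace m d → ℂ) (hF : AnalyticAt ℂ F (z x)), φ = chartGerm hz hx F hF := by
  obtain ⟨f, hf, rfl⟩ := exists_holGerm φ
  exact ⟨_, _, holGerm_eq_chartGerm hz hx hf⟩

/-- The action on germs of an operator `T` on analytic functions of the coordinates. -/
noncomputable def chartOperator (hz : IsHolChart z) (hx : x ∈ z.source)
    (T : (CSpace m d → ℂ) → CSpace m d → ℂ)
    (hT : ∀ F, AnalyticAt ℂ F (z x) → AnalyticAt ℂ (T F) (z x)) (φ : holStalk m d x) :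
    holStalk m d x :=
  chartGerm hz hx (T (exists_chartGerm hz hx φ).choose)
    (hT _ (exists_chartGerm hz hx φ).choose_spec.choose)

theorem chartOperator_chartGerm (hz : IsHolChart z) (hx : x ∈ z.source)
    {T : (CSpace m d → ℂ) → CSpace m d → ℂ}
    (hT : ∀ F, AnalyticAt ℂ F (z x) → AnalyticAt ℂ (T F) (z x))
    (hTc : ∀ F G, F =ᶠ[𝓝 (z x)] G → T F =ᶠ[𝓝 (z x)] T G)
    {F : CSpace m d → ℂ} (hF : AnalyticAt ℂ F (z x)) :
    chartOperator hz hx T hT (chartGerm hz hx F hF) = chartGerm hz hx (T F) (hT F hF) := by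
  rw [chartOperator, chartGerm_eq_iff]
  have h := (exists_chartGerm hz hx (chartGerm hz hx F hF)).choose_spec.choose_spec
  exact hTc _ _ ((chartGerm_eq_iff hz hx).1 h).symm

theorem AnalyticAt.fderiv_apply_const {F : CSpace m d → ℂ} {v₀ : CSpace m d}
    (hF : AnalyticAt ℂ F v₀) (e : CSpace m d) : AnalyticAt ℂ (fun v => fderiv ℂ F v e) v₀ :=
  ((ContinuousLinearMap.apply ℂ ℂ e).analyticAt _).comp hF.fderiv

/-- The partial derivative `∂/∂z^i` as a derivation of the stalk. -/
noncomputable def chartDeriv (hz : IsHolChart z) (hx : x ∈ z.source) (i : Fin (m + d)) :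
    Derivation ℤ (holStalk m d x) (holStalk m d x) :=
  have hT : ∀ F : CSpace m d → ℂ, AnalyticAt ℂ F (z x) →
      AnalyticAt ℂ (fun v => fderiv ℂ F v (Pi.single i 1)) (z x) :=
    fun F hF => hF.fderiv_apply_const _
  have hTc : ∀ F G : CSpace m d → ℂ, F =ᶠ[𝓝 (z x)] G →
      (fun v => fderiv ℂ F v (Pi.single i 1)) =ᶠ[𝓝 (z x)] fun v => fderiv ℂ G v (Pi.single i 1) :=
    fun F G h => by filter_upwards [h.fderiv (𝕜 := ℂ)] with v hv; rw [hv]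
  Derivation.mk' (AddMonoidHom.toIntLinearMap <| AddMonoidHom.mk'
      (chartOperator hz hx (fun F v => fderiv ℂ F v (Pi.single i 1)) hT) <| by
    intro φ ψ
    obtain ⟨F, hF, rfl⟩ := exists_chartGerm hz hx φ
    obtain ⟨G, hG, rfl⟩ := exists_chartGerm hz hx ψ
    have : chartGerm hz hx F hF + chartGerm hz hx G hG
      = chartGerm hz hx (fun v => F v + G v) (hF.fun_add hG) := rfl
    rw [this, chartOperator_chartGerm hz hx hT hTc, chartOperator_chartGerm hz hx hT hTc,
      chartOperator_chartGerm hz hx hT hTc, chartGerm, chartGerm, chartGerm, ← holGerm_add,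
      holGerm_eq_iff]
    refine (eventually_chart_iff hx (P := fun v => fderiv ℂ (fun v => F v + G v) v (Pi.single i 1)
      = fderiv ℂ F v (Pi.single i 1) + fderiv ℂ G v (Pi.single i 1))).2 ?_
    filter_upwards [hF.eventually_analyticAt, hG.eventually_analyticAt] with v h1 h2
    rw [fderiv_fun_add h1.differentiableAt h2.differentiableAt]; rfl) <| by
    intro φ ψ
    obtain ⟨F, hF, rfl⟩ := exists_chartGerm hz hx φ
    obtain ⟨G, hG, rfl⟩ := exists_chartGerm hz hx ψ
    have : chartGerm hz hx F hF * chartGerm hz hx G hG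
      = chartGerm hz hx (fun v => F v * G v) (hF.fun_mul hG) := rfl
    rw [this]
    simp only [AddMonoidHom.coe_toIntLinearMap, AddMonoidHom.mk'_apply, smul_eq_mul]
    rw [chartOperator_chartGerm hz hx hT hTc, chartOperator_chartGerm hz hx hT hTc,
      chartOperator_chartGerm hz hx hT hTc, chartGerm, chartGerm, chartGerm, chartGerm, chartGerm,
      ← holGerm_mul, ← holGerm_mul, ← holGerm_add, holGerm_eq_iff]
    refine (eventually_chart_iff hx (P := fun v => fderiv ℂ (fun v => F v * G v) v (Pi.single i 1)
      = F v * fderiv ℂ G v (Pi.single i 1) + G v * fderiv ℂ F v (Pi.single i 1))).2 ?_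
    filter_upwards [hF.eventually_analyticAt, hG.eventually_analyticAt] with v h1 h2
    rw [fderiv_fun_mul h1.differentiableAt h2.differentiableAt]; rfl

theorem chartDeriv_chartGerm (hz : IsHolChart z) (hx : x ∈ z.source) (i : Fin (m + d))
    {F : CSpace m d → ℂ} (hF : AnalyticAt ℂ F (z x)) :
    chartDeriv hz hx i (chartGerm hz hx F hF)
      = chartGerm hz hx (fun v => fderiv ℂ F v (Pi.single i 1)) (hF.fderiv_apply_const _) :=
  chartOperator_chartGerm hz hx (fun _ hF => hF.fderiv_apply_const _)
    (fun F G h => by filter_upwards [h.fderiv (𝕜 := ℂ)] with v hv; rw [hv]) hF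

theorem AnalyticAt.comp_killNormal {F : CSpace m d → ℂ} {v₀ : CSpace m d} (hF : AnalyticAt ℂ F v₀)
    (hv₀ : killNormal v₀ = v₀) : AnalyticAt ℂ (fun v => F (killNormal v)) v₀ :=
  hF.comp_of_eq (analyticAt_killNormal v₀) hv₀

theorem tendsto_killNormal {v₀ : CSpace m d} (hv₀ : killNormal v₀ = v₀) :
    Tendsto killNormal (𝓝 v₀) (𝓝 v₀) := by
  have := (continuous_killNormal (m := m) (d := d)).tendsto v₀
  rwa [hv₀] at this

/-- The substitution `f ↦ f(0, z'')` on the stalk at a point with coordinates `(0, z'')`. -/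
noncomputable def chartRetr (hz : IsHolChart z) (hx : x ∈ z.source)
    (hk : killNormal (z x) = z x) : holStalk m d x →+* holStalk m d x :=
  have hT : ∀ F : CSpace m d → ℂ, AnalyticAt ℂ F (z x) →
      AnalyticAt ℂ (fun v => F (killNormal v)) (z x) := fun F hF => hF.comp_killNormal hk
  have hTc : ∀ F G : CSpace m d → ℂ, F =ᶠ[𝓝 (z x)] G →
      (fun v => F (killNormal v)) =ᶠ[𝓝 (z x)] fun v => G (killNormal v) :=
    fun _ _ h => (tendsto_killNormal hk).eventually h
  { toFun := chartOperator hz hx (fun F v => F (killNormal v)) hT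
    map_one' := chartOperator_chartGerm hz hx hT hTc (F := fun _ => 1) analyticAt_const
    map_zero' := chartOperator_chartGerm hz hx hT hTc (F := fun _ => 0) analyticAt_const
    map_mul' := by
      intro φ ψ
      obtain ⟨F, hF, rfl⟩ := exists_chartGerm hz hx φ
      obtain ⟨G, hG, rfl⟩ := exists_chartGerm hz hx ψ
      rw [chartOperator_chartGerm hz hx hT hTc, chartOperator_chartGerm hz hx hT hTc]
      exact chartOperator_chartGerm hz hx hT hTc (hF.fun_mul hG)
    map_add' := by
      intro φ ψ
      obtain ⟨F, hF, rfl⟩ := exists_chartGerm hz hx φ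
      obtain ⟨G, hG, rfl⟩ := exists_chartGerm hz hx ψ
      rw [chartOperator_chartGerm hz hx hT hTc, chartOperator_chartGerm hz hx hT hTc]
      exact chartOperator_chartGerm hz hx hT hTc (hF.fun_add hG) }

theorem chartRetr_chartGerm (hz : IsHolChart z) (hx : x ∈ z.source) (hk : killNormal (z x) = z x)
    {F : CSpace m d → ℂ} (hF : AnalyticAt ℂ F (z x)) :
    chartRetr hz hx hk (chartGerm hz hx F hF)
      = chartGerm hz hx (fun v => F (killNormal v)) (hF.comp_killNormal hk) :=
  chartOperator_chartGerm hz hx (fun _ hF => hF.comp_killNormal hk)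
    (fun _ _ h => (tendsto_killNormal hk).eventually h) hF

theorem analyticAt_coord {n : ℕ} (i : Fin n) (v : Fin n → ℂ) : AnalyticAt ℂ (fun v => v i) v :=
  (ContinuousLinearMap.proj (R := ℂ) (φ := fun _ : Fin n => ℂ) i).analyticAt v

/-- The germ of the `i`-th coordinate of the chart `z`. -/
noncomputable def coordGerm (hz : IsHolChart z) (hx : x ∈ z.source) (i : Fin (m + d)) :
    holStalk m d x :=
  chartGerm hz hx (fun v => v i) (analyticAt_coord i _)

/-- The maximal ideal of the stalk is generated by the centred coordinates of any chart. -/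
theorem vanishingIdeal_eq_span (hz : IsHolChart z) (hx : x ∈ z.source) :
    vanishingIdeal m d x
      = Ideal.span (Set.range fun i => coordGerm hz hx i - constStalk m d x (z x i)) := by
  apply le_antisymm
  · intro φ hφ
    obtain ⟨F, hF, rfl⟩ := exists_chartGerm hz hx φ
    have h0 : F (z x) = 0 := hφ
    obtain ⟨h, hh, hsum⟩ := hF.exists_sub_apply_eq_sum
    have : chartGerm hz hx F hF = ∑ i, (coordGerm hz hx i - constStalk m d x (z x i))
        * chartGerm hz hx (h i) (hh i) := by
      have h1 : ∀ i, (coordGerm hz hx i - constStalk m d x (z x i)) * chartGerm hz hx (h i) (hh i)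
          = chartGerm hz hx (fun v => (v i - z x i) * h i v)
            (((analyticAt_coord i _).fun_sub analyticAt_const).fun_mul (hh i)) := fun i => by
        rw [coordGerm, chartGerm, chartGerm, chartGerm]
        change (holGerm _ x _ - holGerm _ x (HolAt.const (z x i))) * _ = _
        rw [← holGerm_sub, ← holGerm_mul]
      rw [Finset.sum_congr rfl fun i _ => h1 i]
      simp only [chartGerm]
      rw [← holGerm_sum Finset.univ, holGerm_eq_iff]
      refine (eventually_chart_iff hx (P := fun v => F v = ∑ i, (v i - z x i) * h i v)).2 ?_
      filter_upwards [hsum] with v hv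
      rw [← hv, h0, sub_zero]
    rw [this]
    exact sum_mem fun i _ => Ideal.mul_mem_right _ _ (Ideal.subset_span ⟨i, rfl⟩)
  · rw [Ideal.span_le]
    rintro _ ⟨i, rfl⟩
    exact sub_constStalk_mem_vanishingIdeal (coordGerm hz hx i)

section Submanifold

variable {S : Set M}

/-- A germ vanishes on `S` iff its expression in a chart with `S = {z' = 0}` satisfies
`F(0, z'') = 0`. -/
theorem chartGerm_mem_idealStalk_iff (hz : IsHolChart z) (hx : x ∈ z.source) (hxS : x ∈ S)
    (hzS : z.source ∩ S = normalZeros z) {F : CSpace m d → ℂ} (hF : AnalyticAt ℂ F (z x)) :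
    chartGerm hz hx F hF ∈ idealStalk m d S x ↔ ∀ᶠ v in 𝓝 (z x), F (killNormal v) = 0 := by
  have hk := (mem_iff_killNormal_eq hzS hx).1 hxS
  constructor
  · rintro ⟨f, hf, hf0⟩
    have h1 : ∀ᶠ y in 𝓝 x, F (z y) = f y := Germ.coe_eq.1 hf
    have h2 : ∀ᶠ y in 𝓝 x, killNormal (z y) = z y → F (z y) = 0 := by
      filter_upwards [h1, hf0, z.open_source.mem_nhds hx] with y h1 h2 h3 h4
      rw [h1, h2 ((mem_iff_killNormal_eq hzS h3).2 h4)]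
    have h3 := (eventually_chart_iff hx (P := fun v => killNormal v = v → F v = 0)).1 h2
    filter_upwards [(tendsto_killNormal hk).eventually h3] with v hv
    exact hv (killNormal_killNormal v)
  · intro h
    refine ⟨fun y => F (z y), rfl, ?_⟩
    filter_upwards [(eventually_chart_iff hx).2 h, z.open_source.mem_nhds hx] with y h1 h2 h3
    rwa [(mem_iff_killNormal_eq hzS h2).1 h3] at h1

/-- The normal coordinates of the stalk at a point of `S` given by a chart in which
`S = {z' = 0}`. -/
noncomputable def chartNormalCoordinates (hz : IsHolChart z) (hx : x ∈ z.source) (hxS : x ∈ S)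
    (hzS : z.source ∩ S = normalZeros z) : NormalCoordinates (idealStalk m d S x) (Fin m) where
  coord r := coordGerm hz hx (Fin.castAdd d r)
  deriv r := chartDeriv hz hx (Fin.castAdd d r)
  retr := chartRetr hz hx ((mem_iff_killNormal_eq hzS hx).1 hxS)
  span_coord := by
    have hk := (mem_iff_killNormal_eq hzS hx).1 hxS
    apply le_antisymm
    · rw [Ideal.span_le]
      rintro _ ⟨r, rfl⟩
      exact (chartGerm_mem_idealStalk_iff hz hx hxS hzS _).2 (Eventually.of_forall fun v => by simp)
    · intro φ hφ
      obtain ⟨F, hF, rfl⟩ := exists_chartGerm hz hx φ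
      rw [chartGerm_mem_idealStalk_iff hz hx hxS hzS] at hφ
      obtain ⟨h, hh, hsum⟩ := hF.exists_sub_killNormal_eq_sum hk
      have : chartGerm hz hx F hF = ∑ r, coordGerm hz hx (Fin.castAdd d r)
          * chartGerm hz hx (h r) (hh r) := by
        simp only [chartGerm, coordGerm, ← holGerm_mul]
        rw [← holGerm_sum Finset.univ, holGerm_eq_iff]
        refine (eventually_chart_iff hx (P := fun v => F v = ∑ r, v (Fin.castAdd d r) * h r v)).2 ?_
        filter_upwards [hsum, hφ] with v hv h0
        rw [← hv, h0, sub_zero]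
      rw [this]
      exact sum_mem fun r _ => Ideal.mul_mem_right _ _ (Ideal.subset_span ⟨r, rfl⟩)
  deriv_coord i j := by
    rw [coordGerm, chartDeriv_chartGerm]
    have h1 : ∀ v : CSpace m d, fderiv ℂ (fun v : CSpace m d => v (Fin.castAdd d j)) v
        (Pi.single (Fin.castAdd d i) 1) = if i = j then 1 else 0 := by
      intro v
      have h2 := (ContinuousLinearMap.proj (R := ℂ) (φ := fun _ : Fin (m + d) => ℂ)
        (Fin.castAdd d j)).hasFDerivAt (x := v)
      have h3 : fderiv ℂ (fun v : CSpace m d => v (Fin.castAdd d j)) v = _ := h2.fderiv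
      rw [h3]
      simp only [ContinuousLinearMap.proj_apply, Pi.single_apply, Fin.castAdd_inj, eq_comm]
    split_ifs with hij
    · refine (chartGerm_eq_iff hz hx (hG := analyticAt_const)).2 (Eventually.of_forall fun v => ?_)
      exact (h1 v).trans (if_pos hij)
    · refine (chartGerm_eq_iff hz hx (hG := analyticAt_const)).2 (Eventually.of_forall fun v => ?_)
      exact (h1 v).trans (if_neg hij)
  deriv_retr i φ := by
    have hk := (mem_iff_killNormal_eq hzS hx).1 hxS
    obtain ⟨F, hF, rfl⟩ := exists_chartGerm hz hx φ
    rw [chartRetr_chartGerm, chartDeriv_chartGerm]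
    refine (chartGerm_eq_iff hz hx (hG := analyticAt_const)).2 ?_
    filter_upwards [(tendsto_killNormal hk).eventually hF.eventually_analyticAt] with v hv
    have h1 : HasFDerivAt (fun v : CSpace m d => killNormal v) (killNormalL m d) v := by
      have := (killNormalL m d).hasFDerivAt (x := v)
      rwa [show ⇑(killNormalL m d) = killNormal from funext killNormalL_apply] at this
    have h2 := hv.differentiableAt.hasFDerivAt.comp v h1
    have h3 : fderiv ℂ (fun v => F (killNormal v)) v = _ := h2.fderiv
    have h4 : killNormalL m d (Pi.single (Fin.castAdd d i) 1) = 0 := by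
      rw [killNormalL_apply]
      funext j
      refine Fin.addCases (fun r => ?_) (fun p => ?_) j
      · simp
      · rw [killNormal_natAdd, Pi.single_apply, if_neg]
        · rfl
        · intro h
          have := congrArg Fin.val h
          simp at this
          omega
    rw [h3, ContinuousLinearMap.comp_apply, h4, map_zero]
  retr_of_mem φ hφ := by
    obtain ⟨F, hF, rfl⟩ := exists_chartGerm hz hx φ
    rw [chartGerm_mem_idealStalk_iff hz hx hxS hzS] at hφ
    rw [chartRetr_chartGerm]
    exact (chartGerm_eq_iff hz hx (hG := analyticAt_const)).2 hφ
  sub_retr_mem φ := by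
    have hk := (mem_iff_killNormal_eq hzS hx).1 hxS
    obtain ⟨F, hF, rfl⟩ := exists_chartGerm hz hx φ
    rw [chartRetr_chartGerm, chartGerm, chartGerm, ← holGerm_sub]
    exact (chartGerm_mem_idealStalk_iff hz hx hxS hzS
      (F := fun v => F v - F (killNormal v)) (hF.fun_sub (hF.comp_killNormal hk))).2
      (Eventually.of_forall fun v => by simp)

end Submanifold

end Stalk

/-! ### Adic separation of the stalks -/

section Separation

variable {m d : ℕ} {M : Type*} [TopologicalSpace M] [ChartedSpace (CSpace m d) M]
  {z : OpenPartialHomeomorph M (CSpace m d)} {x : M}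

theorem AnalyticAt.comp_line {F : CSpace m d → ℂ} {v₀ : CSpace m d} (hF : AnalyticAt ℂ F v₀)
    (v : CSpace m d) : AnalyticAt ℂ (fun s : ℂ => F (v₀ + s • v)) 0 := by
  have h : AnalyticAt ℂ (fun s : ℂ => v₀ + s • v) 0 :=
    analyticAt_const.fun_add (analyticAt_id.fun_smul analyticAt_const)
  exact hF.comp_of_eq h (by simp)

theorem analyticOrderAt_line_congr {F G : CSpace m d → ℂ} {v₀ : CSpace m d} (h : F =ᶠ[𝓝 v₀] G)
    (v : CSpace m d) : analyticOrderAt (fun s : ℂ => F (v₀ + s • v)) 0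
      = analyticOrderAt (fun s : ℂ => G (v₀ + s • v)) 0 := by
  have h1 : Tendsto (fun s : ℂ => v₀ + s • v) (𝓝 0) (𝓝 v₀) := by
    have h2 : Continuous (fun s : ℂ => v₀ + s • v) := by fun_prop
    simpa using h2.tendsto 0
  exact analyticOrderAt_congr (h1.eventually h)

/-- A germ in the `n`-th power of the maximal ideal vanishes to order `n` on every line through the
point. -/
theorem le_analyticOrderAt_line_of_mem_pow (hz : IsHolChart z) (hx : x ∈ z.source) (v : CSpace m d)
    (n : ℕ) : ∀ (F : CSpace m d → ℂ) (hF : AnalyticAt ℂ F (z x)),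
      chartGerm hz hx F hF ∈ vanishingIdeal m d x ^ n →
      (n : ℕ∞) ≤ analyticOrderAt (fun s : ℂ => F (z x + s • v)) 0 := by
  suffices H : ∀ φ ∈ vanishingIdeal m d x ^ n, ∃ (F : CSpace m d → ℂ) (hF : AnalyticAt ℂ F (z x)),
      φ = chartGerm hz hx F hF ∧ (n : ℕ∞) ≤ analyticOrderAt (fun s : ℂ => F (z x + s • v)) 0 by
    intro F hF h
    obtain ⟨G, hG, h1, h2⟩ := H _ h
    rwa [analyticOrderAt_line_congr ((chartGerm_eq_iff hz hx).1 h1)]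
  induction n with
  | zero =>
    intro φ _
    obtain ⟨F, hF, rfl⟩ := exists_chartGerm hz hx φ
    exact ⟨F, hF, rfl, by simp⟩
  | succ n ih =>
    intro φ hφ
    rw [pow_succ'] at hφ
    refine Submodule.mul_induction_on hφ ?_ ?_
    · intro α hα β hβ
      obtain ⟨G, hG, rfl, hord⟩ := ih β hβ
      obtain ⟨F, hF, rfl⟩ := exists_chartGerm hz hx α
      refine ⟨fun v => F v * G v, hF.fun_mul hG, rfl, ?_⟩
      have h0 : F (z x) = 0 := hα
      have h1 : analyticOrderAt (fun s : ℂ => F (z x + s • v)) 0 ≠ 0 := by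
        rw [(hF.comp_line v).analyticOrderAt_ne_zero]
        simpa using h0
      have h2 := analyticOrderAt_mul (hF.comp_line v) (hG.comp_line v)
      change _ ≤ analyticOrderAt ((fun s : ℂ => F (z x + s • v)) * fun s : ℂ => G (z x + s • v)) 0
      rw [h2, Nat.cast_add, Nat.cast_one, add_comm (n : ℕ∞)]
      exact add_le_add (Order.one_le_iff_ne_zero.2 h1) hord
    · rintro _ _ ⟨F, hF, rfl, h1⟩ ⟨G, hG, rfl, h2⟩
      exact ⟨fun v => F v + G v, hF.fun_add hG, rfl, (le_min h1 h2).trans le_analyticOrderAt_add⟩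

/-- Krull's intersection theorem for the stalk: a germ vanishing to infinite order is zero. -/
theorem eq_zero_of_forall_mem_vanishingIdeal_pow (hz : IsHolChart z) (hx : x ∈ z.source)
    (φ : holStalk m d x) (h : ∀ n, φ ∈ vanishingIdeal m d x ^ n) : φ = 0 := by
  obtain ⟨F, hF, rfl⟩ := exists_chartGerm hz hx φ
  refine (chartGerm_eq_iff hz hx (hG := analyticAt_const)).2
    (hF.eventually_eq_zero_of_lines dense_univ fun v _ => ?_)
  rw [← analyticOrderAt_eq_top]
  exact ENat.eq_top_iff_forall_ge.2 fun n => le_analyticOrderAt_line_of_mem_pow hz hx v n F hF (h n)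

/-- In the stalk at a point where the coordinate `t = z^i` vanishes, `b ∑ j! t^j` is represented by a
convergent germ only if `b = 0`: restrict to the lines on which `t` is not constant. -/
theorem eq_zero_of_mul_factorial_coordGerm (hz : IsHolChart z) (hx : x ∈ z.source)
    (i : Fin (m + d)) (hi : z x i = 0) (a b : holStalk m d x)
    (h : ∀ n, a - b * ∑ j ∈ Finset.range n, ((j.factorial : ℕ) : holStalk m d x)
      * coordGerm hz hx i ^ j ∈ vanishingIdeal m d x ^ n) : b = 0 := by
  obtain ⟨A, hA, rfl⟩ := exists_chartGerm hz hx a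
  obtain ⟨B, hB, rfl⟩ := exists_chartGerm hz hx b
  have hterm : ∀ j : ℕ, AnalyticAt ℂ (fun v : CSpace m d => (j.factorial : ℂ) * v i ^ j) (z x) :=
    fun j => analyticAt_const.fun_mul ((analyticAt_coord i _).fun_pow j)
  have hσ : ∀ n : ℕ, AnalyticAt ℂ
      (fun v : CSpace m d => ∑ j ∈ Finset.range n, (j.factorial : ℂ) * v i ^ j) (z x) := fun n =>
    Finset.analyticAt_fun_sum _ fun j _ => hterm j
  have hσg : ∀ n : ℕ, ∑ j ∈ Finset.range n, ((j.factorial : ℕ) : holStalk m d x)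
      * coordGerm hz hx i ^ j = chartGerm hz hx _ (hσ n) := by
    intro n
    have h1 : ∀ j : ℕ, ((j.factorial : ℕ) : holStalk m d x) * coordGerm hz hx i ^ j
        = chartGerm hz hx _ (hterm j) := by
      intro j
      rw [← map_natCast (constStalk m d x)]
      rfl
    simp only [h1, chartGerm]
    rw [← holGerm_sum (Finset.range n)]
  refine (chartGerm_eq_iff hz hx (hG := analyticAt_const)).2
    (hB.eventually_eq_zero_of_lines (dense_setOf_apply_ne_zero i) fun v hv => ?_)
  refine eventually_eq_zero_of_mul_factorial (hA.comp_line v) (hB.comp_line v)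
    (w := v i) hv fun n => ?_
  have h2 := h n
  rw [hσg] at h2
  have h3 : chartGerm hz hx A hA - chartGerm hz hx B hB * chartGerm hz hx _ (hσ n)
      = chartGerm hz hx (fun v => A v - B v * ∑ j ∈ Finset.range n, (j.factorial : ℂ) * v i ^ j)
        (hA.fun_sub (hB.fun_mul (hσ n))) := by
    simp only [chartGerm]
    rw [← holGerm_mul, ← holGerm_sub]
  rw [h3] at h2
  have h4 := le_analyticOrderAt_line_of_mem_pow hz hx v n _ _ h2
  simpa [hi, mul_comm] using h4

variable {S : Set M}

theorem chartRetr_mem_vanishingIdeal (hz : IsHolChart z) (hx : x ∈ z.source)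
    (hk : killNormal (z x) = z x) (φ : holStalk m d x) (hφ : φ ∈ vanishingIdeal m d x) :
    chartRetr hz hx hk φ ∈ vanishingIdeal m d x := by
  obtain ⟨F, hF, rfl⟩ := exists_chartGerm hz hx φ
  rw [chartRetr_chartGerm]
  have h0 : F (z x) = 0 := hφ
  change F (killNormal (z x)) = 0
  rw [hk, h0]

/-- The powers of the ideal of `S` are closed in the adic topology of the stalk. -/
theorem mem_idealStalk_pow_of_forall_mem_sup (hz : IsHolChart z) (hx : x ∈ z.source) (hxS : x ∈ S)
    (hzS : z.source ∩ S = normalZeros z) (j : ℕ) (φ : holStalk m d x)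
    (h : ∀ n, φ ∈ vanishingIdeal m d x ^ n ⊔ idealStalk m d S x ^ j) :
    φ ∈ idealStalk m d S x ^ j :=
  (chartNormalCoordinates hz hx hxS hzS).mem_pow_of_forall_mem_sup (isUnit_natCast_holStalk x)
    (chartRetr_mem_vanishingIdeal hz hx ((mem_iff_killNormal_eq hzS hx).1 hxS))
    (eq_zero_of_forall_mem_vanishingIdeal_pow hz hx) j φ h

end Separation

/-! ### The alternating Taylor sum -/

section Taylor

variable {m d : ℕ}

/-- The term `∑ (∂^l F / ∂z^{r_1} ⋯ ∂z^{r_l}) z^{r_1} ⋯ z^{r_l}` of the alternating Taylor sum, as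
the `l`-th derivative evaluated on the normal part of the point. -/
noncomputable def taylorTerm (F : CSpace m d → ℂ) (l : ℕ) (v : CSpace m d) : ℂ :=
  iteratedFDeriv ℂ l F v fun _ => v - killNormal v

theorem sub_killNormal_eq_sum (v : CSpace m d) :
    v - killNormal v = ∑ r : Fin m, v (Fin.castAdd d r) • Pi.single (Fin.castAdd d r) (1 : ℂ) := by
  rw [pi_eq_sum_univ' (v - killNormal v), Fin.sum_univ_add]
  simp

theorem taylorTerm_eq_sum (F : CSpace m d → ℂ) (l : ℕ) (v : CSpace m d) :
    taylorTerm F l v = ∑ r : Fin l → Fin m,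
      iteratedFDeriv ℂ l F v (fun a => Pi.single (Fin.castAdd d (r a)) 1)
        * ∏ a, v (Fin.castAdd d (r a)) := by
  rw [taylorTerm, sub_killNormal_eq_sum, ContinuousMultilinearMap.map_sum]
  refine Finset.sum_congr rfl fun r _ => ?_
  rw [ContinuousMultilinearMap.map_smul_univ, smul_eq_mul, mul_comm]

theorem alternatingTaylor_eq_sum {M : Type*} [TopologicalSpace M]
    (z : OpenPartialHomeomorph M (CSpace m d)) (k : ℕ) (f : M → ℂ) :
    alternatingTaylor z k f = fun y => ∑ l ∈ Finset.range (k + 1),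
      ((-1 : ℂ) ^ l * (1 / (l.factorial : ℂ))) * taylorTerm (f ∘ z.symm) l (z y) := by
  funext y
  simp only [alternatingTaylor, taylorTerm_eq_sum, chartPartial]

theorem AnalyticAt.iteratedFDeriv_complex {F : CSpace m d → ℂ} {v₀ : CSpace m d}
    (hF : AnalyticAt ℂ F v₀) (l : ℕ) : AnalyticAt ℂ (iteratedFDeriv ℂ l F) v₀ := by
  rw [← contDiffAt_omega_iff_analyticAt_complex] at hF ⊢
  exact hF.iteratedFDeriv_right (by simp)

theorem AnalyticAt.iteratedFDeriv_apply_const {F : CSpace m d → ℂ} {v₀ : CSpace m d}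
    (hF : AnalyticAt ℂ F v₀) {l : ℕ} (e : Fin l → CSpace m d) :
    AnalyticAt ℂ (fun v => iteratedFDeriv ℂ l F v e) v₀ :=
  ((ContinuousMultilinearMap.apply ℂ (fun _ : Fin l => CSpace m d) ℂ e).analyticAt _).comp
    (hF.iteratedFDeriv_complex l)

theorem AnalyticAt.taylorTerm {F : CSpace m d → ℂ} {v₀ : CSpace m d} (hF : AnalyticAt ℂ F v₀)
    (l : ℕ) : AnalyticAt ℂ (taylorTerm F l) v₀ := by
  rw [show _root_.taylorTerm F l = _ from funext (taylorTerm_eq_sum F l)]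
  exact Finset.analyticAt_fun_sum _ fun r _ => (hF.iteratedFDeriv_apply_const _).fun_mul
    (Finset.analyticAt_fun_prod _ fun a _ => analyticAt_coord _ _)

/-- The Euler vector field applied to a Taylor term. Along the line `v + s n` through `v` in the
normal direction `n` the term is `(1 + s) ^ l` times an iterated derivative on constant vectors. -/
theorem fderiv_taylorTerm {F : CSpace m d → ℂ} {v : CSpace m d} (hF : AnalyticAt ℂ F v) (l : ℕ) :
    fderiv ℂ (taylorTerm F l) v (v - killNormal v)
      = taylorTerm F (l + 1) v + l * taylorTerm F l v := by
  set n := v - killNormal v with hn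
  have hline : HasDerivAt (fun s : ℂ => v + s • n) n 0 := by
    simpa using ((hasDerivAt_id (0 : ℂ)).smul_const n).const_add v
  have hv0 : v + (0 : ℂ) • n = v := by simp
  have h1 : HasDerivAt (fun s : ℂ => taylorTerm F l (v + s • n)) (fderiv ℂ (taylorTerm F l) v n) 0 := by
    have h := (hF.taylorTerm l).differentiableAt.hasFDerivAt
    rw [← hv0] at h
    have := h.comp_hasDerivAt (0 : ℂ) hline
    rwa [hv0] at this
  have hkn : killNormal n = 0 := by
    rw [← killNormalL_apply, hn, map_sub, killNormalL_apply, killNormalL_apply,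
      killNormal_killNormal, sub_self]
  have h2 : ∀ s : ℂ, taylorTerm F l (v + s • n)
      = (1 + s) ^ l * iteratedFDeriv ℂ l F (v + s • n) (fun _ => n) := by
    intro s
    have h3 : v + s • n - killNormal (v + s • n) = (1 + s) • n := by
      rw [← killNormalL_apply, map_add, map_smul, killNormalL_apply, killNormalL_apply, hkn,
        smul_zero, add_zero, add_smul, one_smul, add_sub_right_comm]
    rw [taylorTerm, h3, ContinuousMultilinearMap.map_smul_univ]
    simp
  have h4 : HasDerivAt (fun s : ℂ => iteratedFDeriv ℂ l F (v + s • n) (fun _ => n))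
      (taylorTerm F (l + 1) v) 0 := by
    have h := (hF.iteratedFDeriv_complex l).differentiableAt.hasFDerivAt
    rw [← hv0] at h
    have h5 := h.comp_hasDerivAt (0 : ℂ) hline
    rw [hv0] at h5
    have h6 := (ContinuousMultilinearMap.apply ℂ (fun _ : Fin l => CSpace m d) ℂ
      (fun _ => n)).hasFDerivAt.comp_hasDerivAt (0 : ℂ) h5
    rw [taylorTerm, iteratedFDeriv_succ_apply_left]
    exact h6
  have h7 : HasDerivAt (fun s : ℂ => (1 + s) ^ l) (l : ℂ) 0 := by
    simpa using ((hasDerivAt_id (0 : ℂ)).const_add 1).fun_pow l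
  have h8 := (h7.fun_mul h4).congr_of_eventuallyEq (Eventually.of_forall h2)
  rw [h1.unique h8, hv0, add_comm]
  simp [taylorTerm, hn]

variable {M : Type*} [TopologicalSpace M] [ChartedSpace (CSpace m d) M] {S : Set M}
  {z : OpenPartialHomeomorph M (CSpace m d)} {x : M}

theorem euler_chartGerm (hz : IsHolChart z) (hx : x ∈ z.source) (hxS : x ∈ S)
    (hzS : z.source ∩ S = normalZeros z) {F G : CSpace m d → ℂ} (hF : AnalyticAt ℂ F (z x))
    (hG : AnalyticAt ℂ G (z x)) (h : ∀ᶠ v in 𝓝 (z x), fderiv ℂ F v (v - killNormal v) = G v) :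
    (chartNormalCoordinates hz hx hxS hzS).euler (chartGerm hz hx F hF)
      = chartGerm hz hx G hG := by
  rw [NormalCoordinates.euler_apply]
  change ∑ r, coordGerm hz hx (Fin.castAdd d r)
    * chartDeriv hz hx (Fin.castAdd d r) (chartGerm hz hx F hF) = _
  simp only [chartDeriv_chartGerm]
  simp only [chartGerm, coordGerm, ← holGerm_mul]
  rw [← holGerm_sum Finset.univ, holGerm_eq_iff]
  refine (eventually_chart_iff hx (P := fun v => ∑ r : Fin m, v (Fin.castAdd d r)
    * fderiv ℂ F v (Pi.single (Fin.castAdd d r) 1) = G v)).2 ?_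
  filter_upwards [h] with v hv
  rw [← hv, sub_killNormal_eq_sum, map_sum]
  simp

theorem holAt_comp_retraction (hz : IsHolChart z) (hx : x ∈ z.source)
    (hk : killNormal (z x) = z x) {f : M → ℂ} (hf : HolAt m d f x) :
    HolAt m d (fun y => f (z.symm (killNormal (z y)))) x :=
  holAt_comp_chart hz hx (((holAt_iff hz hx).1 hf).comp_killNormal hk)

theorem chartRetr_holGerm (hz : IsHolChart z) (hx : x ∈ z.source)
    (hk : killNormal (z x) = z x) {f : M → ℂ} (hf : HolAt m d f x) :
    chartRetr hz hx hk (holGerm f x hf) = holGerm (fun y => f (z.symm (killNormal (z y)))) x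
      (holAt_comp_retraction hz hx hk hf) := by
  rw [holGerm_eq_chartGerm hz hx hf, chartRetr_chartGerm]
  rfl

theorem HolAt.alternatingTaylor (hz : IsHolChart z) (hx : x ∈ z.source) (k : ℕ) {f : M → ℂ}
    (hf : HolAt m d f x) : HolAt m d (alternatingTaylor z k f) x := by
  rw [alternatingTaylor_eq_sum]
  exact HolAt.sum fun l =>
    (HolAt.const _).mul (holAt_comp_chart hz hx (((holAt_iff hz hx).1 hf).taylorTerm l))

/-- The alternating Taylor sum of `f` is congruent to `f(0, z'')` modulo `I_S ^ (k + 1)`. -/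
theorem alternatingTaylor_sub_chartRetr_mem (hz : IsHolChart z) (hx : x ∈ z.source) (hxS : x ∈ S)
    (hzS : z.source ∩ S = normalZeros z) (k : ℕ) {f : M → ℂ} (hf : HolAt m d f x) :
    holGerm (alternatingTaylor z k f) x (hf.alternatingTaylor hz hx k)
      - chartRetr hz hx ((mem_iff_killNormal_eq hzS hx).1 hxS) (holGerm f x hf)
        ∈ idealStalk m d S x ^ (k + 1) := by
  have hF := (holAt_iff hz hx).1 hf
  set N := chartNormalCoordinates hz hx hxS hzS with hN
  set A : ℕ → holStalk m d x := fun l => chartGerm hz hx _ (hF.taylorTerm l) with hA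
  set c : ℕ → ℂ := fun l => (-1 : ℂ) ^ l * (1 / (l.factorial : ℂ)) with hc
  have hA0 : A 0 = holGerm f x hf := by
    rw [holGerm_eq_chartGerm hz hx, hA]
    refine (chartGerm_eq_iff hz hx).2 (Eventually.of_forall fun v => ?_)
    simp [taylorTerm]
  have hEA : ∀ l, A (l + 1) = N.euler (A l) - (l : holStalk m d x) * A l := by
    intro l
    rw [eq_sub_iff_add_eq, ← map_natCast (constStalk m d x)]
    have hG : AnalyticAt ℂ (fun v => taylorTerm (f ∘ z.symm) (l + 1) v
        + (l : ℂ) * taylorTerm (f ∘ z.symm) l v) (z x) :=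
      (hF.taylorTerm _).fun_add (analyticAt_const.fun_mul (hF.taylorTerm l))
    refine Eq.trans ?_ (euler_chartGerm hz hx hxS hzS (hF.taylorTerm l) hG ?_).symm
    · rfl
    · filter_upwards [hF.eventually_analyticAt] with v hv using fderiv_taylorTerm hv l
  have hcE : ∀ l, N.euler (constStalk m d x (c l)) = 0 := by
    intro l
    refine euler_chartGerm hz hx hxS hzS (F := fun _ => c l) (G := fun _ => 0) analyticAt_const
      analyticAt_const (Eventually.of_forall fun v => ?_)
    simp
  have hcs : ∀ l : ℕ, ((l + 1 : ℕ) : holStalk m d x) * constStalk m d x (c (l + 1))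
      = -constStalk m d x (c l) := by
    intro l
    rw [← map_natCast (constStalk m d x), ← map_mul, ← map_neg]
    congr 1
    simp only [hc, Nat.factorial_succ]
    have h1 : (l.factorial : ℂ) ≠ 0 := Nat.cast_ne_zero.2 l.factorial_ne_zero
    have h2 : ((l + 1 : ℕ) : ℂ) ≠ 0 := Nat.cast_ne_zero.2 l.succ_ne_zero
    push_cast at h2 ⊢
    field_simp
    ring
  have key := N.sum_taylor_sub_retr_mem (isUnit_natCast_holStalk x) k A
    (fun l => constStalk m d x (c l)) hEA (by simp [hc]) hcs hcE
  rw [hA0] at key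
  convert key using 2
  swap
  · rfl
  have h3 : ∀ l, constStalk m d x (c l) * A l
      = holGerm (fun y => c l * taylorTerm (f ∘ z.symm) l (z y)) x
        ((HolAt.const _).mul (holAt_comp_chart hz hx (hF.taylorTerm l))) := fun l => rfl
  simp only [h3]
  rw [← holGerm_sum (Finset.range (k + 1)), holGerm_eq_iff, alternatingTaylor_eq_sum]

end Taylor

/-! ### Liftings on stalks -/

section LiftingStalk

variable {m d : ℕ} {M : Type*} [TopologicalSpace M] [ChartedSpace (CSpace m d) M]
  {S : Set M} {k : ℕ}

theorem thetaStalk_mk (x : M) (φ : holStalk m d x) :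
    thetaStalk m d S k x (Ideal.Quotient.mk _ φ) = Ideal.Quotient.mk _ φ := rfl

theorem sub_mem_of_thetaStalk_mk_eq {x : M} {φ ψ : holStalk m d x}
    (h : thetaStalk m d S k x (Ideal.Quotient.mk _ φ) = Ideal.Quotient.mk _ ψ) :
    φ - ψ ∈ idealStalk m d S x := by
  rw [thetaStalk_mk, Ideal.Quotient.mk_eq_mk_iff_sub_mem, pow_one] at h
  exact h

/-- A lifting preserves the unit: `1 - ρ 1` is idempotent, and nilpotent since it lies in
`I_S / I_S ^ (k + 1)`. -/
theorem Lifting.toHom_one (ρ : Lifting m d S k) (x : S) : ρ.toHom x 1 = 1 := by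
  obtain ⟨φ, hφ⟩ := Ideal.Quotient.mk_surjective (ρ.toHom x 1)
  have h1 : φ - 1 ∈ idealStalk m d S (x : M) := by
    apply sub_mem_of_thetaStalk_mk_eq (k := k)
    rw [hφ, ρ.theta_toHom, map_one]
  have h2 : IsIdempotentElem (1 - ρ.toHom x 1) := by
    apply IsIdempotentElem.one_sub
    change ρ.toHom x 1 * ρ.toHom x 1 = _
    rw [← map_mul, one_mul]
  have h3 : (1 - ρ.toHom x 1) ^ (k + 1) = 0 := by
    rw [← hφ, ← map_one (Ideal.Quotient.mk _), ← map_sub, ← map_pow,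
      Ideal.Quotient.eq_zero_iff_mem]
    refine Ideal.pow_mem_pow ?_ _
    rw [← neg_sub]
    exact neg_mem h1
  rw [h2.pow_succ_eq k, sub_eq_zero] at h3
  exact h3.symm

/-- The ring homomorphism `φ ↦ ρ [φ]_1` on the stalk `O_{M,x}`. -/
noncomputable def Lifting.stalkHom (ρ : Lifting m d S k) (x : S) :
    holStalk m d (x : M) →+* nbhdStalk m d S (k + 1) (x : M) :=
  RingHom.comp { ρ.toHom x with map_one' := ρ.toHom_one x } (Ideal.Quotient.mk _)

theorem Lifting.stalkHom_apply (ρ : Lifting m d S k) (x : S) (φ : holStalk m d (x : M)) :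
    ρ.stalkHom x φ = ρ.toHom x (Ideal.Quotient.mk _ φ) := rfl

theorem Lifting.sub_mem_of_stalkHom_eq (ρ : Lifting m d S k) {x : S} {φ ψ : holStalk m d (x : M)}
    (h : ρ.stalkHom x φ = Ideal.Quotient.mk _ ψ) : ψ - φ ∈ idealStalk m d S (x : M) := by
  apply sub_mem_of_thetaStalk_mk_eq (k := k)
  rw [← h, ρ.stalkHom_apply, ρ.theta_toHom]

theorem Lifting.stalkHom_eq_zero (ρ : Lifting m d S k) {x : S} {φ : holStalk m d (x : M)}
    (h : φ ∈ idealStalk m d S (x : M)) : ρ.stalkHom x φ = 0 := by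
  rw [ρ.stalkHom_apply, Ideal.Quotient.eq_zero_iff_mem.2 (by rwa [pow_one]), map_zero]

theorem Lifting.stalkHom_mem_map (ρ : Lifting m d S k) {x : S} {φ : holStalk m d (x : M)}
    (h : φ ∈ vanishingIdeal m d (x : M)) : ρ.stalkHom x φ ∈ (vanishingIdeal m d (x : M)).map
      (Ideal.Quotient.mk (idealStalk m d S (x : M) ^ (k + 1))) := by
  obtain ⟨ψ, hψ⟩ := Ideal.Quotient.mk_surjective (ρ.stalkHom x φ)
  rw [← hψ]
  apply Ideal.mem_map_of_mem
  have := add_mem (idealStalk_le_vanishingIdeal x.2 (ρ.sub_mem_of_stalkHom_eq hψ.symm)) h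
  rwa [sub_add_cancel] at this

theorem Lifting.maps_iff (ρ : Lifting m d S k) {x : S} {f g : M → ℂ} (hf : HolAt m d f (x : M))
    (hg : HolAt m d g (x : M)) : ρ.Maps x f g ↔
      ρ.stalkHom x (holGerm f x hf) = Ideal.Quotient.mk _ (holGerm g x hg) :=
  ⟨fun ⟨_, _, h⟩ => h, fun h => ⟨hf, hg, h⟩⟩

variable {z : OpenPartialHomeomorph M (CSpace m d)}

theorem chartRetr_constStalk {x : M} (hz : IsHolChart z) (hx : x ∈ z.source)
    (hk : killNormal (z x) = z x) (c : ℂ) :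
    chartRetr hz hx hk (constStalk m d x c) = constStalk m d x c :=
  chartRetr_chartGerm hz hx hk (F := fun _ => c) analyticAt_const

theorem chartRetr_coordGerm_natAdd {x : M} (hz : IsHolChart z) (hx : x ∈ z.source)
    (hk : killNormal (z x) = z x) (p : Fin d) :
    chartRetr hz hx hk (coordGerm hz hx (Fin.natAdd m p)) = coordGerm hz hx (Fin.natAdd m p) := by
  rw [coordGerm, chartRetr_chartGerm, chartGerm_eq_iff]
  exact Eventually.of_forall fun v => by simp

/-- A lifting which fixes the constants and the tangential coordinates of a chart is, on the stalk,
the substitution `f ↦ f(0, z'')` in that chart. -/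
theorem Lifting.stalkHom_eq_of_coord (ρ : Lifting m d S k) {x : S} (hz : IsHolChart z)
    (hx : (x : M) ∈ z.source) (hzS : z.source ∩ S = normalZeros z)
    (hk : killNormal (z (x : M)) = z (x : M))
    (hc : ∀ c : ℂ, ρ.stalkHom x (constStalk m d (x : M) c)
      = Ideal.Quotient.mk _ (constStalk m d (x : M) c))
    (hcoord : ∀ p : Fin d, ρ.stalkHom x (coordGerm hz hx (Fin.natAdd m p))
      = Ideal.Quotient.mk _ (coordGerm hz hx (Fin.natAdd m p))) :
    ρ.stalkHom x = (Ideal.Quotient.mk _).comp (chartRetr hz hx hk) := by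
  refine RingHom.eq_of_eq_on_generators
    (fun i => coordGerm hz hx i - constStalk m d (x : M) (z (x : M) i)) (vanishingIdeal_eq_span hz hx)
    (mem_idealStalk_pow_of_forall_mem_sup hz hx x.2 hzS (k + 1)) _ _
    (fun φ hφ => ρ.stalkHom_mem_map hφ)
    (fun φ hφ => Ideal.mem_map_of_mem _ (chartRetr_mem_vanishingIdeal hz hx hk φ hφ)) (fun i => ?_)
    (fun φ => ⟨_, ?_, sub_constStalk_mem_vanishingIdeal φ⟩)
  · rw [map_sub, map_sub, hc, RingHom.comp_apply, RingHom.comp_apply, chartRetr_constStalk]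
    congr 1
    refine Fin.addCases (fun r => ?_) (fun p => ?_) i
    · have h1 := (chartNormalCoordinates hz hx x.2 hzS).coord_mem r
      rw [show coordGerm hz hx (Fin.castAdd d r)
        = (chartNormalCoordinates hz hx x.2 hzS).coord r from rfl, ρ.stalkHom_eq_zero h1]
      rw [show chartRetr hz hx hk _ = 0 from
        (chartNormalCoordinates hz hx x.2 hzS).retr_of_mem _ h1, map_zero]
    · rw [hcoord, chartRetr_coordGerm_natAdd]
  · rw [hc, RingHom.comp_apply, chartRetr_constStalk]

end LiftingStalk

/-! ### Splitting atlases and liftings -/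

section Atlas

theorem chartPartial_one {m d : ℕ} {M : Type*} [TopologicalSpace M]
    (z : OpenPartialHomeomorph M (CSpace m d)) (i : Fin (m + d)) (f : M → ℂ) :
    chartPartial z (l := 1) (fun _ => i) f
      = fun y => fderiv ℂ (f ∘ z.symm) (z y) (Pi.single i 1) := by
  funext y
  rw [chartPartial, iteratedFDeriv_one_apply]

variable {m d : ℕ} {M : Type*} [TopologicalSpace M] [ChartedSpace (CSpace m d) M]
  {S : Set M} {k : ℕ} {𝔘 : Set (OpenPartialHomeomorph M (CSpace m d))}
  {z w : OpenPartialHomeomorph M (CSpace m d)} {x : M}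

theorem IsAdaptedAtlas.inter_eq_normalZeros (h𝔘 : IsAdaptedAtlas S 𝔘) (hz : z ∈ 𝔘)
    (hx : x ∈ z.source) (hxS : x ∈ S) : z.source ∩ S = normalZeros z := by
  rcases h𝔘.adapted z hz with h | h
  · exact absurd (h.le ⟨hx, hxS⟩) (Set.notMem_empty x)
  · exact h.2

theorem IsAdaptedAtlas.killNormal_eq (h𝔘 : IsAdaptedAtlas S 𝔘) (hz : z ∈ 𝔘)
    (hx : x ∈ z.source) (hxS : x ∈ S) : killNormal (z x) = z x :=
  (mem_iff_killNormal_eq (h𝔘.inter_eq_normalZeros hz hx hxS) hx).1 hxS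

theorem IsAdaptedAtlas.notMem_closure (h𝔘 : IsAdaptedAtlas S 𝔘) (hz : z ∈ 𝔘) {y : M}
    (hy : y ∈ z.source) (hyS : y ∈ S) (hx : x ∈ z.source) (hxS : x ∉ S) : x ∉ closure S := by
  intro h
  rcases h𝔘.adapted z hz with h1 | h1
  · exact Set.notMem_empty y (h1.le ⟨hy, hyS⟩)
  · exact hxS (h1.1.ge ⟨hx, h⟩).2

theorem idealStalk_eq_top (h : x ∉ closure S) : idealStalk m d S x = ⊤ := by
  rw [Ideal.eq_top_iff_one]
  refine ⟨1, rfl, ?_⟩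
  filter_upwards [isClosed_closure.isOpen_compl.mem_nhds h] with y hy hyS
  exact absurd (subset_closure hyS) hy

theorem holAt_coord (hz : IsHolChart z) (hx : x ∈ z.source) (i : Fin (m + d)) :
    HolAt m d (fun y => z y i) x :=
  holAt_comp_chart hz hx (analyticAt_coord i _)

theorem chartDeriv_holGerm (hz : IsHolChart z) (hx : x ∈ z.source) (i : Fin (m + d)) {f : M → ℂ}
    (hf : HolAt m d f x) : ∃ h : HolAt m d (chartPartial z (l := 1) (fun _ => i) f) x,
      chartDeriv hz hx i (holGerm f x hf) = holGerm _ x h := by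
  rw [holGerm_eq_chartGerm hz hx hf, chartDeriv_chartGerm, chartPartial_one]
  exact ⟨_, rfl⟩

theorem memIdealPow_chartPartial_iff (hz : IsHolChart z) (hx : x ∈ z.source) (i : Fin (m + d))
    {f : M → ℂ} (hf : HolAt m d f x) :
    MemIdealPow m d S k (chartPartial z (l := 1) (fun _ => i) f) x
      ↔ chartDeriv hz hx i (holGerm f x hf) ∈ idealStalk m d S x ^ k := by
  obtain ⟨h, heq⟩ := chartDeriv_holGerm hz hx i hf
  rw [heq]
  exact ⟨fun ⟨_, h'⟩ => h', fun h' => ⟨h, h'⟩⟩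

/-- The chain rule for a change of charts, on the stalk. -/
theorem chartDeriv_chartGerm_eq_sum (hz : IsHolChart z) (hx : x ∈ z.source) (hw : IsHolChart w)
    (hxw : x ∈ w.source) (j : Fin (m + d)) {G : CSpace m d → ℂ} (hG : AnalyticAt ℂ G (w x)) :
    chartDeriv hz hx j (chartGerm hw hxw G hG)
      = ∑ i, chartDeriv hz hx j (coordGerm hw hxw i)
        * chartDeriv hw hxw i (chartGerm hw hxw G hG) := by
  have hH : ∀ i, AnalyticAt ℂ (fun v => w (z.symm v) i) (z x) := fun i =>
    (holAt_iff hz hx).1 (holAt_coord hw hxw i)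
  have hwG : chartGerm hw hxw G hG = holGerm (fun y => G (w y)) x (holAt_comp_chart hw hxw hG) :=
    rfl
  have hcoord : ∀ i, chartDeriv hz hx j (coordGerm hw hxw i)
      = chartGerm hz hx _ ((hH i).fderiv_apply_const (Pi.single j 1)) := by
    intro i
    rw [show coordGerm hw hxw i = holGerm _ x (holAt_coord hw hxw i) from rfl,
      holGerm_eq_chartGerm hz hx, chartDeriv_chartGerm]
    rfl
  have hderiv : chartDeriv hz hx j (chartGerm hw hxw G hG)
      = chartGerm hz hx _ (((holAt_iff hz hx).1
        (holAt_comp_chart hw hxw hG)).fderiv_apply_const (Pi.single j 1)) := by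
    rw [hwG, holGerm_eq_chartGerm hz hx, chartDeriv_chartGerm]
  rw [hderiv]
  simp only [hcoord, chartDeriv_chartGerm]
  simp only [chartGerm, ← holGerm_mul]
  rw [← holGerm_sum Finset.univ, holGerm_eq_iff]
  have hHpi : AnalyticAt ℂ (fun v => w (z.symm v)) (z x) := analyticAt_pi_iff.2 hH
  have e1 := (eventually_chart_iff hx).2 hHpi.eventually_analyticAt
  have e2 : ∀ᶠ y in 𝓝 x, AnalyticAt ℂ G (w y) :=
    (eventually_chart_iff hxw).2 hG.eventually_analyticAt
  filter_upwards [e1, e2, eventually_symm_apply hx] with y h1 h2 h3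
  have h4 := h1.differentiableAt.hasFDerivAt
  have h5 : HasFDerivAt G (fderiv ℂ G (w y)) (w (z.symm (z y))) := by
    rw [h3]; exact h2.differentiableAt.hasFDerivAt
  have h6 : fderiv ℂ ((fun y => G (w y)) ∘ z.symm) (z y) = _ := (h5.comp (z y) h4).fderiv
  rw [h6, ContinuousLinearMap.comp_apply, ContinuousLinearMap.apply_eq_sum_single]
  refine Finset.sum_congr rfl fun i _ => ?_
  have h7 : fderiv ℂ (fun v => w (z.symm v) i) (z y) = _ := (hasFDerivAt_pi'.1 h4 i).fderiv
  rw [h7]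
  rfl

/-- If the transition from the chart `z` to the chart `w` satisfies the `k`-splitting condition
then the local liftings of the two charts agree. -/
theorem chartRetr_sub_chartRetr_mem (hz : IsHolChart z) (hx : x ∈ z.source) (hw : IsHolChart w)
    (hxw : x ∈ w.source) (hxS : x ∈ S) (hzS : z.source ∩ S = normalZeros z)
    (hwS : w.source ∩ S = normalZeros w) (hkz : killNormal (z x) = z x)
    (hkw : killNormal (w x) = w x)
    (hsplit : ∀ (r : Fin m) (p : Fin d), chartDeriv hz hx (Fin.castAdd d r)
      (coordGerm hw hxw (Fin.natAdd m p)) ∈ idealStalk m d S x ^ k) (φ : holStalk m d x) :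
    chartRetr hw hxw hkw φ - chartRetr hz hx hkz φ ∈ idealStalk m d S x ^ (k + 1) := by
  set Nz := chartNormalCoordinates hz hx hxS hzS
  set Nw := chartNormalCoordinates hw hxw hxS hwS
  have h1 : Nz.retr φ = Nz.retr (Nw.retr φ) := by
    rw [← sub_eq_zero, ← map_sub]
    exact Nz.retr_of_mem _ (Nw.sub_retr_mem φ)
  change Nw.retr φ - Nz.retr φ ∈ _
  rw [h1]
  refine Nz.sub_retr_mem_pow (isUnit_natCast_holStalk x) fun r => ?_
  obtain ⟨G, hG, hG'⟩ := exists_chartGerm hw hxw (Nw.retr φ)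
  rw [hG']
  change chartDeriv hz hx (Fin.castAdd d r) _ ∈ _
  rw [chartDeriv_chartGerm_eq_sum hz hx hw hxw, Fin.sum_univ_add, ← hG']
  refine add_mem (sum_mem fun i _ => ?_) (sum_mem fun p _ => ?_)
  · rw [show chartDeriv hw hxw (Fin.castAdd d i) (Nw.retr φ) = 0 from Nw.deriv_retr i φ, mul_zero]
    exact zero_mem _
  · exact Ideal.mul_mem_right _ _ (hsplit r p)

/-- The local lifting `[f]_1 ↦ [f(0, z'')]_{k+1}` on the stalk at a point of `S`. -/
noncomputable def localLifting (k : ℕ) (hz : IsHolChart z) (hx : x ∈ z.source) (hxS : x ∈ S)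
    (hzS : z.source ∩ S = normalZeros z) : nbhdStalk m d S 1 x →+* nbhdStalk m d S (k + 1) x :=
  Ideal.Quotient.lift _
    ((Ideal.Quotient.mk _).comp (chartNormalCoordinates hz hx hxS hzS).retr) fun φ hφ => by
      rw [pow_one] at hφ
      rw [RingHom.comp_apply, (chartNormalCoordinates hz hx hxS hzS).retr_of_mem φ hφ, map_zero]

theorem localLifting_mk (hz : IsHolChart z) (hx : x ∈ z.source) (hxS : x ∈ S)
    (hzS : z.source ∩ S = normalZeros z) (φ : holStalk m d x) :
    localLifting k hz hx hxS hzS (Ideal.Quotient.mk _ φ) = Ideal.Quotient.mk _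
      (chartRetr hz hx ((mem_iff_killNormal_eq hzS hx).1 hxS) φ) := rfl

/-- A lifting whose action on stalks is the substitution `f ↦ f(0, z'')` in every chart of the
atlas makes the atlas `k`-splitting. -/
theorem isKSplittingAtlas_of_stalkHom (h𝔘 : IsAdaptedAtlas S 𝔘) (ρ : Lifting m d S k)
    (hρ : ∀ z (hz : z ∈ 𝔘) (x : S) (hx : (x : M) ∈ z.source), ρ.stalkHom x
      = (Ideal.Quotient.mk _).comp
        (chartRetr (h𝔘.holomorphic hz) hx (h𝔘.killNormal_eq hz hx x.2))) :
    IsKSplittingAtlas S k 𝔘 := by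
  rintro zα hα zβ hβ ⟨y, ⟨hyα, -⟩, hyS⟩ r p x ⟨hxα, hxβ⟩
  rw [memIdealPow_chartPartial_iff (h𝔘.holomorphic hα) hxα _
    (holAt_coord (h𝔘.holomorphic hβ) hxβ _)]
  by_cases hxS : x ∈ S
  · have h1 := hρ zα hα ⟨x, hxS⟩ hxα
    rw [hρ zβ hβ ⟨x, hxS⟩ hxβ] at h1
    have h2 := congrArg (fun σ => σ (coordGerm (h𝔘.holomorphic hβ) hxβ (Fin.natAdd m p))) h1
    simp only [RingHom.comp_apply] at h2
    rw [chartRetr_coordGerm_natAdd, Ideal.Quotient.mk_eq_mk_iff_sub_mem] at h2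
    set N := chartNormalCoordinates (h𝔘.holomorphic hα) hxα hxS
      (h𝔘.inter_eq_normalZeros hα hxα hxS)
    have h3 := (N.deriv r).apply_mem_pow _ k _ h2
    rw [map_sub, show N.deriv r (chartRetr _ _ _ _) = 0 from N.deriv_retr r _, sub_zero] at h3
    exact h3
  · rw [idealStalk_eq_top (h𝔘.notMem_closure hα hyα hyS hxα hxS), Ideal.top_pow]
    exact Submodule.mem_top

/-- The local liftings of a `k`-splitting atlas patch together. -/
theorem exists_lifting_of_isKSplittingAtlas [IsManifold 𝓘(ℂ, CSpace m d) ω M]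
    (h𝔘 : IsAdaptedAtlas S 𝔘) (hsplit : IsKSplittingAtlas S k 𝔘) :
    ∃ ρ : Lifting m d S k, ∀ z (hz : z ∈ 𝔘) (x : S) (hx : (x : M) ∈ z.source), ρ.stalkHom x
      = (Ideal.Quotient.mk _).comp
        (chartRetr (h𝔘.holomorphic hz) hx (h𝔘.killNormal_eq hz hx x.2)) := by
  have hchart : ∀ x : S, ∃ z, z ∈ 𝔘 ∧ (x : M) ∈ z.source := fun x =>
    h𝔘.covers x fun h => h.2 x.2
  choose c hc hcx using hchart
  have hagree : ∀ (x : S) z (hz : z ∈ 𝔘) (hx : (x : M) ∈ z.source) (φ : holStalk m d (x : M)),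
      localLifting k (h𝔘.holomorphic (hc x)) (hcx x) x.2
        (h𝔘.inter_eq_normalZeros (hc x) (hcx x) x.2) (Ideal.Quotient.mk _ φ)
      = Ideal.Quotient.mk _ (chartRetr (h𝔘.holomorphic hz) hx (h𝔘.killNormal_eq hz hx x.2) φ) := by
    intro x z hz hx φ
    rw [localLifting_mk, Ideal.Quotient.mk_eq_mk_iff_sub_mem]
    refine chartRetr_sub_chartRetr_mem (h𝔘.holomorphic hz) hx (h𝔘.holomorphic (hc x)) (hcx x) x.2
      (h𝔘.inter_eq_normalZeros hz hx x.2) (h𝔘.inter_eq_normalZeros (hc x) (hcx x) x.2) _ _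
      (fun r p => ?_) φ
    exact (memIdealPow_chartPartial_iff (h𝔘.holomorphic hz) hx _
      (holAt_coord (h𝔘.holomorphic (hc x)) (hcx x) _)).1
      (hsplit z hz (c x) (hc x) ⟨x, ⟨hx, hcx x⟩, x.2⟩ r p x ⟨hx, hcx x⟩)
  refine ⟨{ toHom := fun x => localLifting k (h𝔘.holomorphic (hc x)) (hcx x) x.2
              (h𝔘.inter_eq_normalZeros (hc x) (hcx x) x.2)
            locally_hol := ?_
            theta_toHom := ?_ }, ?_⟩
  · intro U hU f hf x hxU
    have hg := (holAt_comp_retraction (h𝔘.holomorphic (hc x)) (hcx x)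
      (h𝔘.killNormal_eq (hc x) (hcx x) x.2) (hf x hxU)).eventually
    obtain ⟨V, hV, hVo, hxV⟩ := mem_nhds_iff.1 (hg.and ((hU.eventually_mem hxU).and
      ((c x).open_source.eventually_mem (hcx x))))
    refine ⟨V, hVo, hxV, fun y hy => (hV hy).2.1, _, fun y hy => (hV hy).1, fun y hy => ?_⟩
    refine (hagree y (c x) (hc x) (hV hy).2.2 _).trans ?_
    rw [chartRetr_holGerm]
    rfl
  · intro x s
    obtain ⟨φ, rfl⟩ := Ideal.Quotient.mk_surjective s
    change thetaStalk m d S k x (localLifting k (h𝔘.holomorphic (hc x)) (hcx x) x.2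
      (h𝔘.inter_eq_normalZeros (hc x) (hcx x) x.2) (Ideal.Quotient.mk _ φ)) = _
    rw [localLifting_mk, thetaStalk_mk, Ideal.Quotient.mk_eq_mk_iff_sub_mem, pow_one, ← neg_sub]
    exact neg_mem ((chartNormalCoordinates (h𝔘.holomorphic (hc x)) (hcx x) x.2
      (h𝔘.inter_eq_normalZeros (hc x) (hcx x) x.2)).sub_retr_mem φ)
  · intro z hz x hx
    refine RingHom.ext fun φ => ?_
    rw [Lifting.stalkHom_apply]
    exact hagree x z hz hx φ

theorem localLiftingsPatchTo_iff (h𝔘 : IsAdaptedAtlas S 𝔘) (ρ : Lifting m d S k) :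
    LocalLiftingsPatchTo 𝔘 ρ ↔ ∀ z (hz : z ∈ 𝔘) (x : S) (hx : (x : M) ∈ z.source), ρ.stalkHom x
      = (Ideal.Quotient.mk _).comp
        (chartRetr (h𝔘.holomorphic hz) hx (h𝔘.killNormal_eq hz hx x.2)) := by
  constructor
  · intro h z hz x hx
    refine RingHom.ext fun φ => ?_
    obtain ⟨f, hf, rfl⟩ := exists_holGerm φ
    rw [RingHom.comp_apply, chartRetr_holGerm]
    exact (ρ.maps_iff hf _).1 (h z hz x hx f hf)
  · intro h z hz x hx f hf
    rw [ρ.maps_iff hf (holAt_comp_retraction (h𝔘.holomorphic hz) hx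
      (h𝔘.killNormal_eq hz hx x.2) hf), h z hz x hx, RingHom.comp_apply, chartRetr_holGerm]

theorem maps_alternatingTaylor_iff (h𝔘 : IsAdaptedAtlas S 𝔘) (ρ : Lifting m d S k) (hz : z ∈ 𝔘)
    {x : S} (hx : (x : M) ∈ z.source) {f : M → ℂ} (hf : HolAt m d f (x : M)) :
    ρ.Maps x f (alternatingTaylor z k f) ↔ ρ.stalkHom x (holGerm f x hf) = Ideal.Quotient.mk _
      (chartRetr (h𝔘.holomorphic hz) hx (h𝔘.killNormal_eq hz hx x.2) (holGerm f x hf)) := by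
  rw [ρ.maps_iff hf (hf.alternatingTaylor (h𝔘.holomorphic hz) hx k),
    (Ideal.Quotient.mk_eq_mk_iff_sub_mem _ _).2 (alternatingTaylor_sub_chartRetr_mem
      (h𝔘.holomorphic hz) hx x.2 (h𝔘.inter_eq_normalZeros hz hx x.2) k hf)]

/-- The atlas is adapted to `ρ` iff `ρ` is `[f]_1 ↦ [f(0, z'')]_{k+1}` on stalks, in every chart.
Here the Taylor formula is needed only for the constants and the tangential coordinates, which
determine `ρ`, in one direction, and for all `f` in the other. -/
theorem isAdaptedTo_iff (h𝔘 : IsAdaptedAtlas S 𝔘) (ρ : Lifting m d S k) :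
    IsAdaptedTo 𝔘 ρ ↔ ∀ z (hz : z ∈ 𝔘) (x : S) (hx : (x : M) ∈ z.source), ρ.stalkHom x
      = (Ideal.Quotient.mk _).comp
        (chartRetr (h𝔘.holomorphic hz) hx (h𝔘.killNormal_eq hz hx x.2)) := by
  constructor
  · intro h z hz x hx
    have hz' := h𝔘.holomorphic hz
    refine ρ.stalkHom_eq_of_coord hz' hx (h𝔘.inter_eq_normalZeros hz hx x.2) _ (fun c => ?_)
      fun p => ?_
    · have h1 := (maps_alternatingTaylor_iff h𝔘 ρ hz hx (HolAt.const c)).1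
        (h z hz _ (fun y _ => HolAt.const c) x hx)
      refine h1.trans ?_
      congr 1
      exact chartRetr_constStalk hz' hx _ c
    · have h1 := (maps_alternatingTaylor_iff h𝔘 ρ hz hx (holAt_coord hz' hx (Fin.natAdd m p))).1
        (h z hz _ (fun y hy => holAt_coord hz' hy _) x hx)
      refine h1.trans ?_
      congr 1
      exact chartRetr_coordGerm_natAdd hz' hx _ p
  · intro h z hz f hf x hx
    rw [maps_alternatingTaylor_iff h𝔘 ρ hz hx (hf x hx), h z hz x hx]
    rfl

theorem isKSplittingAtlas_iff_exists_isAdaptedTo [IsManifold 𝓘(ℂ, CSpace m d) ω M]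
    (h𝔘 : IsAdaptedAtlas S 𝔘) :
    IsKSplittingAtlas S k 𝔘 ↔ ∃ ρ : Lifting m d S k, IsAdaptedTo 𝔘 ρ := by
  simp only [isAdaptedTo_iff h𝔘]
  exact ⟨exists_lifting_of_isKSplittingAtlas h𝔘,
    fun ⟨ρ, hρ⟩ => isKSplittingAtlas_of_stalkHom h𝔘 ρ hρ⟩

theorem isKSplittingAtlas_iff_exists_localLiftingsPatchTo [IsManifold 𝓘(ℂ, CSpace m d) ω M]
    (h𝔘 : IsAdaptedAtlas S 𝔘) :
    IsKSplittingAtlas S k 𝔘 ↔ ∃ ρ : Lifting m d S k, LocalLiftingsPatchTo 𝔘 ρ := by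
  simp only [localLiftingsPatchTo_iff h𝔘]
  exact ⟨exists_lifting_of_isKSplittingAtlas h𝔘,
    fun ⟨ρ, hρ⟩ => isKSplittingAtlas_of_stalkHom h𝔘 ρ hρ⟩

end Atlas

/-! ### Automatic linearity over the constants -/

/-- Every complex number is within distance `1` of the Gaussian integers. -/
theorem exists_norm_add_int_add_int_mul_I_le (y : ℂ) :
    ∃ p q : ℤ, ‖y + (p + q * Complex.I)‖ ≤ 1 := by
  refine ⟨-round y.re, -round y.im, (Complex.norm_le_abs_re_add_abs_im _).trans ?_⟩
  have h1 := abs_sub_round y.re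
  have h2 := abs_sub_round y.im
  have h3 : (y + (((-round y.re : ℤ) : ℂ) + ((-round y.im : ℤ) : ℂ) * Complex.I)).re
      = y.re - round y.re := by simp [sub_eq_add_neg]
  have h4 : (y + (((-round y.re : ℤ) : ℂ) + ((-round y.im : ℤ) : ℂ) * Complex.I)).im
      = y.im - round y.im := by simp [sub_eq_add_neg]
  rw [h3, h4]
  linarith

section Constants

variable {m d : ℕ} {M : Type*} [TopologicalSpace M] [ChartedSpace (CSpace m d) M]
  {S : Set M} {k : ℕ} {z : OpenPartialHomeomorph M (CSpace m d)}

theorem Lifting.isNilpotent_stalkHom_sub (ρ : Lifting m d S k) (x : S)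
    (φ : holStalk m d (x : M)) : IsNilpotent (ρ.stalkHom x φ - Ideal.Quotient.mk _ φ) := by
  obtain ⟨ψ, hψ⟩ := Ideal.Quotient.mk_surjective (ρ.stalkHom x φ)
  refine ⟨k + 1, ?_⟩
  rw [← hψ, ← map_sub, ← map_pow, Ideal.Quotient.eq_zero_iff_mem]
  exact Ideal.pow_mem_pow (ρ.sub_mem_of_stalkHom_eq hψ.symm) _

/-- A lifting fixes `√-1`: two square roots of `-1` which differ by a nilpotent are equal. -/
theorem Lifting.stalkHom_constStalk_I (ρ : Lifting m d S k) (x : S) :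
    ρ.stalkHom x (constStalk m d (x : M) Complex.I)
      = Ideal.Quotient.mk _ (constStalk m d (x : M) Complex.I) := by
  set a := ρ.stalkHom x (constStalk m d (x : M) Complex.I) with ha
  set b : nbhdStalk m d S (k + 1) (x : M) :=
    Ideal.Quotient.mk _ (constStalk m d (x : M) Complex.I) with hb
  have h1 : a * a = -1 := by
    rw [ha, ← map_mul, ← map_mul, Complex.I_mul_I, map_neg, map_one, map_neg, map_one]
  have h2 : b * b = -1 := by
    rw [hb, ← map_mul, ← map_mul, Complex.I_mul_I, map_neg, map_one, map_neg, map_one]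
  have h3 : IsNilpotent (a - b) := ρ.isNilpotent_stalkHom_sub x _
  have h4 : IsUnit (2 * b) := by
    have : (2 * b : nbhdStalk m d S (k + 1) (x : M))
        = Ideal.Quotient.mk _ (constStalk m d (x : M) (2 * Complex.I)) := by
      rw [map_mul, map_mul, map_ofNat, map_ofNat]
    rw [this]
    exact ((isUnit_iff_ne_zero.2 (by simp)).map _).map _
  have h5 : IsUnit (2 * b + (a - b)) := h3.isUnit_add_left_of_commute h4 (Commute.all _ _)
  have h6 : (2 * b + (a - b)) * (a - b) = 0 := by linear_combination h1 - h2
  exact sub_eq_zero.1 ((h5.mul_right_eq_zero).1 h6)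

/-- A lifting on the stalk at the origin of a chart which fixes one tangential coordinate `t` fixes
the constants. If `ρ c = c + Δ`, choose `r_j ∈ ℤ[i]` with `a_j = j! c + r_j` bounded; then `ρ` maps
the convergent series `∑ a_j t^j` to `∑ a_j t^j + Δ ∑ j! t^j`, which forces `Δ = 0`. -/
theorem Lifting.stalkHom_constStalk (ρ : Lifting m d S k) (x : S) (hz : IsHolChart z)
    (hx : (x : M) ∈ z.source) (hzS : z.source ∩ S = normalZeros z) (p : Fin d)
    (hp : z (x : M) (Fin.natAdd m p) = 0)
    (hcoord : ρ.stalkHom x (coordGerm hz hx (Fin.natAdd m p))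
      = Ideal.Quotient.mk _ (coordGerm hz hx (Fin.natAdd m p))) (c : ℂ) :
    ρ.stalkHom x (constStalk m d (x : M) c) = Ideal.Quotient.mk _ (constStalk m d (x : M) c) := by
  set N := chartNormalCoordinates hz hx x.2 hzS with hN
  have hk : killNormal (z (x : M)) = z (x : M) := (mem_iff_killNormal_eq hzS hx).1 x.2
  set t := coordGerm hz hx (Fin.natAdd m p) with ht
  obtain ⟨ψ, hψ⟩ := Ideal.Quotient.mk_surjective (ρ.stalkHom x (constStalk m d (x : M) c))
  rw [← hψ, Ideal.Quotient.mk_eq_mk_iff_sub_mem]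
  choose r s hrs using fun j : ℕ => exists_norm_add_int_add_int_mul_I_le ((j.factorial : ℂ) * c)
  set a : ℕ → ℂ := fun j => (j.factorial : ℂ) * c + (r j + s j * Complex.I) with ha
  have ha1 : ∀ j, ‖a j‖ ≤ 1 := hrs
  have hσa : ∀ j, ρ.stalkHom x (constStalk m d (x : M) (a j)) = Ideal.Quotient.mk _
      (constStalk m d (x : M) (a j) + ((j.factorial : ℕ) : holStalk m d (x : M))
        * (ψ - constStalk m d (x : M) c)) := by
    intro j
    simp only [ha, map_add, map_mul, map_natCast, map_intCast, map_sub, ← hψ,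
      ρ.stalkHom_constStalk_I x]
    ring
  -- the convergent series `∑ a_{j + n} t^j`
  have hf : ∀ n : ℕ, AnalyticAt ℂ (fun v : CSpace m d =>
      ∑' j, a (j + n) * v (Fin.natAdd m p) ^ j) (z (x : M)) := fun n =>
    (analyticAt_tsum_of_bounded fun j => ha1 (j + n)).comp_of_eq
      (analyticAt_coord (Fin.natAdd m p) (z (x : M))) hp
  set f : ℕ → holStalk m d (x : M) := fun n => chartGerm hz hx _ (hf n) with hfdef
  have hexp : ∀ n, f 0 = ∑ j ∈ Finset.range n, constStalk m d (x : M) (a j) * t ^ j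
      + t ^ n * f n := by
    intro n
    have hterm : ∀ j : ℕ, constStalk m d (x : M) (a j) * t ^ j = chartGerm hz hx
        (fun v => a j * v (Fin.natAdd m p) ^ j)
        (analyticAt_const.fun_mul ((analyticAt_coord _ _).fun_pow j)) := fun j => rfl
    have hrest : t ^ n * f n = chartGerm hz hx (fun v => v (Fin.natAdd m p) ^ n
        * ∑' j, a (j + n) * v (Fin.natAdd m p) ^ j)
        (((analyticAt_coord _ _).fun_pow n).fun_mul (hf n)) := rfl
    rw [hrest]
    simp only [hterm, hfdef, chartGerm]
    rw [← holGerm_sum (Finset.range n), ← holGerm_add, holGerm_eq_iff]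
    refine (eventually_chart_iff hx (P := fun v => ∑' j, a (j + 0) * v (Fin.natAdd m p) ^ j
      = ∑ j ∈ Finset.range n, a j * v (Fin.natAdd m p) ^ j + v (Fin.natAdd m p) ^ n
        * ∑' j, a (j + n) * v (Fin.natAdd m p) ^ j)).2 ?_
    have hsmall : ∀ᶠ v : CSpace m d in 𝓝 (z (x : M)), ‖v (Fin.natAdd m p)‖ < 1 := by
      have h1 : Continuous fun v : CSpace m d => ‖v (Fin.natAdd m p)‖ := by fun_prop
      exact h1.continuousAt.eventually_lt continuousAt_const (by simp [hp])
    filter_upwards [hsmall] with v hv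
    exact tsum_eq_sum_range_add_pow_mul ha1 hv n
  choose H hH using fun n => Ideal.Quotient.mk_surjective (ρ.stalkHom x (f n))
  refine N.mem_pow_of_formal_mul (isUnit_natCast_holStalk (x : M))
    (chartRetr_mem_vanishingIdeal hz hx hk) (t := t) hp
    (chartRetr_coordGerm_natAdd hz hx hk p) Nat.factorial
    (eq_zero_of_mul_factorial_coordGerm hz hx (Fin.natAdd m p) hp) (k + 1)
    (H 0 - f 0) (ψ - constStalk m d (x : M) c) fun n => ?_
  have h1 : H 0 - (∑ j ∈ Finset.range n, (constStalk m d (x : M) (a j)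
      + ((j.factorial : ℕ) : holStalk m d (x : M)) * (ψ - constStalk m d (x : M) c)) * t ^ j
      + t ^ n * H n) ∈ idealStalk m d S (x : M) ^ (k + 1) := by
    rw [← Ideal.Quotient.mk_eq_mk_iff_sub_mem, hH, hexp n]
    simp only [map_add, map_sum, map_mul, map_pow, hσa, hcoord, hH]
  have h2 : t ^ n * (H n - f n) ∈ vanishingIdeal m d (x : M) ^ n :=
    Ideal.mul_mem_right _ _ (Ideal.pow_mem_pow (show t ∈ vanishingIdeal m d (x : M) from hp) n)
  have h3 := Submodule.add_mem_sup h2 h1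
  convert h3 using 1
  rw [hexp n]
  simp only [add_mul, Finset.sum_add_distrib, Finset.mul_sum]
  have h4 : ∑ j ∈ Finset.range n, (ψ - constStalk m d (x : M) c)
      * (((j.factorial : ℕ) : holStalk m d (x : M)) * t ^ j)
      = ∑ j ∈ Finset.range n, ((j.factorial : ℕ) : holStalk m d (x : M))
        * (ψ - constStalk m d (x : M) c) * t ^ j :=
    Finset.sum_congr rfl fun j _ => by ring
  rw [h4]
  ring

end Constants

/-! ### Charts adapted to a lifting -/

section AdaptedChart

variable {m d : ℕ} {M : Type*} [TopologicalSpace M]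

/-- If `S = {z' = 0}` in the domain of a chart, then `S` is closed there, so the chart is adapted. -/
theorem isAdaptedChart_of_inter_eq {S : Set M} {z : OpenPartialHomeomorph M (CSpace m d)}
    (hzS : z.source ∩ S = normalZeros z) : IsAdaptedChart S z := by
  refine Or.inr ⟨Set.Subset.antisymm (Set.inter_subset_inter_right _ subset_closure) ?_, hzS⟩
  rintro y ⟨hy, hyS⟩
  rw [hzS]
  refine ⟨hy, fun r => ?_⟩
  by_contra hne
  have h1 : ContinuousAt (fun y => z y (Fin.castAdd d r)) y :=
    (continuous_apply (Fin.castAdd d r)).continuousAt.comp (z.continuousAt hy)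
  obtain ⟨y', hy'S, hy', hy'z⟩ := ((mem_closure_iff_frequently.1 hyS).and_eventually
    ((h1.eventually_ne hne).and (z.open_source.eventually_mem hy))).exists
  exact hy' ((hzS.le ⟨hy'z, hy'S⟩).2 r)

variable [ChartedSpace (CSpace m d) M] [IsManifold 𝓘(ℂ, CSpace m d) ω M] {S : Set M}

/-- Charts of the given kind around the points of `S`, together with charts that do not meet the
closure of `S`, form an adapted atlas. -/
theorem exists_isAdaptedAtlas {P : OpenPartialHomeomorph M (CSpace m d) → Prop}
    (h : ∀ x ∈ S, ∃ z : OpenPartialHomeomorph M (CSpace m d), IsHolChart z ∧ x ∈ z.source ∧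
      z.source ∩ S = normalZeros z ∧ P z) :
    ∃ 𝔘 : Set (OpenPartialHomeomorph M (CSpace m d)), IsAdaptedAtlas S 𝔘 ∧
      ∀ z ∈ 𝔘, (z.source ∩ S).Nonempty → P z := by
  refine ⟨{z | IsHolChart z ∧ (z.source ∩ S = ∅ ∨ (z.source ∩ S = normalZeros z ∧ P z))},
    ⟨fun z hz => hz.1, fun x hx => ?_, fun z hz => ?_⟩, fun z hz hne => ?_⟩
  · by_cases hxS : x ∈ S
    · obtain ⟨z, hz, hxz, hzS, hP⟩ := h x hxS
      exact ⟨z, ⟨hz, Or.inr ⟨hzS, hP⟩⟩, hxz⟩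
    · have hxc : x ∉ closure S := fun hxc => hx ⟨hxc, hxS⟩
      have hopen : IsOpen (closure S)ᶜ := isClosed_closure.isOpen_compl
      refine ⟨(chartAt (CSpace m d) x).restr (closure S)ᶜ,
        ⟨restr_mem_maximalAtlas _ (IsManifold.chart_mem_maximalAtlas x) hopen, Or.inl ?_⟩, ?_⟩
      · rw [(chartAt (CSpace m d) x).restr_source' _ hopen, Set.eq_empty_iff_forall_notMem]
        exact fun y hy => hy.1.2 (subset_closure hy.2)
      · rw [(chartAt (CSpace m d) x).restr_source' _ hopen]
        exact ⟨mem_chart_source _ x, hxc⟩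
  · rcases hz.2 with h0 | h0
    · exact Or.inl h0
    · exact isAdaptedChart_of_inter_eq h0.1
  · rcases hz.2 with h0 | h0
    · exact absurd h0 hne.ne_empty
    · exact h0.2

/-- New holomorphic coordinates `Φ ∘ z` near `x`, for `Φ` analytic with injective derivative, on a
domain inside a given neighbourhood of `x`. -/
theorem exists_chart_of_fderiv_injective {z : OpenPartialHomeomorph M (CSpace m d)} {x : M}
    (hz : IsHolChart z) (hx : x ∈ z.source) {Φ : CSpace m d → CSpace m d}
    (hΦ : AnalyticAt ℂ Φ (z x)) (hinj : ∀ u, fderiv ℂ Φ (z x) u = 0 → u = 0) {W : Set M}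
    (hW : W ∈ 𝓝 x) : ∃ w : OpenPartialHomeomorph M (CSpace m d), IsHolChart w ∧ x ∈ w.source ∧
      w.source ⊆ z.source ∩ W ∧ ∀ y, w y = Φ (z y) := by
  have hinj' : Function.Injective (fderiv ℂ Φ (z x) : CSpace m d →ₗ[ℂ] CSpace m d) :=
    (injective_iff_map_eq_zero _).2 hinj
  set A : CSpace m d ≃L[ℂ] CSpace m d :=
    (LinearEquiv.ofInjectiveEndo _ hinj').toContinuousLinearEquiv with hA
  have hA' : (A : CSpace m d →L[ℂ] CSpace m d) = fderiv ℂ Φ (z x) := by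
    ext u; rfl
  have hΦc : ContDiffAt ℂ ω Φ (z x) := contDiffAt_omega_iff_analyticAt_complex.2 hΦ
  have hΦd : HasFDerivAt Φ (A : CSpace m d →L[ℂ] CSpace m d) (z x) := by
    rw [hA']; exact hΦ.differentiableAt.hasFDerivAt
  set e := hΦc.toOpenPartialHomeomorph Φ hΦd (by simp) with he
  have heΦ : ∀ v, e v = Φ v := fun v => rfl
  have hxe : z x ∈ e.source := hΦc.mem_toOpenPartialHomeomorph_source hΦd (by simp)
  have hesymm : AnalyticAt ℂ e.symm (Φ (z x)) :=
    contDiffAt_omega_iff_analyticAt_complex.1 (hΦc.to_localInverse hΦd (by simp))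
  have e1 : ∀ᶠ y in 𝓝 x, AnalyticAt ℂ Φ (z y) :=
    (eventually_chart_iff hx).2 hΦ.eventually_analyticAt
  have e2 : ∀ᶠ y in 𝓝 x, AnalyticAt ℂ e.symm (Φ (z y)) :=
    (eventually_chart_iff hx (P := fun v => AnalyticAt ℂ e.symm (Φ v))).2
      (hΦ.continuousAt.eventually hesymm.eventually_analyticAt)
  obtain ⟨V, hV, hVo, hxV⟩ := mem_nhds_iff.1 (e1.and (e2.and hW))
  have hsrc : ((z.trans e).restr V).source = (z.source ∩ z ⁻¹' e.source) ∩ V := by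
    rw [(z.trans e).restr_source' _ hVo, OpenPartialHomeomorph.trans_source]
  have hval : ∀ y, (z.trans e).restr V y = Φ (z y) := fun y => rfl
  refine ⟨(z.trans e).restr V, OpenPartialHomeomorph.mem_maximalAtlas_of_contMDiffOn _ ?_ ?_, ?_,
    ?_, hval⟩
  · intro y hy
    rw [hsrc] at hy
    refine ContMDiffAt.contMDiffWithinAt ?_
    have h1 : ContMDiffAt 𝓘(ℂ, CSpace m d) 𝓘(ℂ, CSpace m d) ω Φ (z y) :=
      (contDiffAt_omega_iff_analyticAt_complex.2 (hV hy.2).1).contMDiffAt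
    exact h1.comp y (contMDiffAt_of_mem_maximalAtlas hz hy.1.1)
  · intro u hu
    set y := ((z.trans e).restr V).symm u with hy
    have hyu : Φ (z y) = u := by rw [← hval]; exact ((z.trans e).restr V).right_inv hu
    have hys : y ∈ ((z.trans e).restr V).source := ((z.trans e).restr V).map_target hu
    rw [hsrc] at hys
    refine ContMDiffAt.contMDiffWithinAt ?_
    have h1 : ContMDiffAt 𝓘(ℂ, CSpace m d) 𝓘(ℂ, CSpace m d) ω e.symm u := by
      rw [← hyu]
      exact (contDiffAt_omega_iff_analyticAt_complex.2 (hV hys.2).2.1).contMDiffAt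
    have h2 : e.symm u = z y := by
      rw [← hyu, ← heΦ, e.left_inv hys.1.2]
    have h3 : ContMDiffAt 𝓘(ℂ, CSpace m d) 𝓘(ℂ, CSpace m d) ω z.symm (e.symm u) := by
      rw [h2]
      exact contMDiffAt_symm_of_mem_maximalAtlas hz (z.map_source hys.1.1)
    exact h3.comp u h1
  · rw [hsrc]; exact ⟨⟨hx, hxe⟩, hxV⟩
  · rw [hsrc]; exact fun y hy => ⟨hy.1.1, (hV hy.2).2.2⟩

variable {k : ℕ}

/-- Near each point of `S` there is a chart, centred at the point, whose tangential coordinates are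
fixed by the given lifting: replace the tangential coordinates `z''` by representatives of
`ρ [z'']_1`, which agree with `z''` on `S`. -/
theorem Lifting.exists_chart (hS : IsComplexSubmanifold m d S) (ρ : Lifting m d S k) (x : S) :
    ∃ w : OpenPartialHomeomorph M (CSpace m d), ∃ hw : IsHolChart w, (x : M) ∈ w.source ∧
      w.source ∩ S = normalZeros w ∧ w (x : M) = 0 ∧
      ∀ (y : S) (hy : (y : M) ∈ w.source) (p : Fin d),
        ρ.stalkHom y (coordGerm hw hy (Fin.natAdd m p))
          = Ideal.Quotient.mk _ (coordGerm hw hy (Fin.natAdd m p)) := by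
  obtain ⟨z, hz, hx, hzS⟩ := hS x x.2
  have hk := (mem_iff_killNormal_eq hzS hx).1 x.2
  set f : Fin d → M → ℂ := fun p y => z y (Fin.natAdd m p) - z (x : M) (Fin.natAdd m p) with hf
  have hfh : ∀ p, ∀ y ∈ z.source, HolAt m d (f p) y := fun p y hy =>
    (holAt_coord hz hy _).sub (HolAt.const _)
  choose V hVo hxV hVz g hg hρ using fun p =>
    ρ.locally_hol z.source z.open_source (f p) (hfh p) x hx
  have hρ' : ∀ p (y : S) (hy : (y : M) ∈ V p),
      ρ.stalkHom y (holGerm (f p) y (hfh p y (hVz p hy)))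
        = Ideal.Quotient.mk _ (holGerm (g p) y (hg p y hy)) := hρ
  have hsub : ∀ p (y : S) (hy : (y : M) ∈ V p), holGerm (g p) y (hg p y hy)
      - holGerm (f p) y (hfh p y (hVz p hy)) ∈ idealStalk m d S (y : M) := fun p y hy =>
    ρ.sub_mem_of_stalkHom_eq (hρ' p y hy)
  have hgx : ∀ p, AnalyticAt ℂ (g p ∘ z.symm) (z x) := fun p =>
    (holAt_iff hz hx).1 (hg p x (hxV p))
  set Φ : CSpace m d → CSpace m d := fun v =>
    Fin.addCases (fun r => v (Fin.castAdd d r)) (fun p => g p (z.symm v)) with hΦdef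
  have hΦn : ∀ v r, Φ v (Fin.castAdd d r) = v (Fin.castAdd d r) := fun v r => by simp [hΦdef]
  have hΦt : ∀ v p, Φ v (Fin.natAdd m p) = g p (z.symm v) := fun v p => by simp [hΦdef]
  have hΦ : AnalyticAt ℂ Φ (z x) := by
    refine analyticAt_pi_iff.2 fun i => ?_
    refine Fin.addCases (fun r => ?_) (fun p => ?_) i
    · exact (analyticAt_coord _ _).congr (Eventually.of_forall fun v => (hΦn v r).symm)
    · exact (hgx p).congr (Eventually.of_forall fun v => (hΦt v p).symm)
  -- on the tangent space of `S` the new tangential coordinates have the derivative of the old ones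
  have hgk : ∀ p, ∀ᶠ v in 𝓝 (z (x : M)), g p (z.symm (killNormal v))
      = v (Fin.natAdd m p) - z (x : M) (Fin.natAdd m p) := by
    intro p
    have h1 := hsub p x (hxV p)
    rw [← holGerm_sub, holGerm_eq_chartGerm hz hx,
      chartGerm_mem_idealStalk_iff hz hx x.2 hzS] at h1
    filter_upwards [h1, (tendsto_killNormal hk).eventually
      (z.open_target.eventually_mem (z.map_source hx))] with v h2 h3
    simp only [Function.comp_apply, hf, z.right_inv h3, killNormal_natAdd] at h2
    exact sub_eq_zero.1 h2
  have hinj : ∀ u, fderiv ℂ Φ (z x) u = 0 → u = 0 := by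
    intro u hu
    have hcomp : ∀ i, fderiv ℂ (fun v => Φ v i) (z x) u = 0 := by
      intro i
      have h1 : fderiv ℂ (fun v => Φ v i) (z x) = _ :=
        (hasFDerivAt_pi'.1 hΦ.differentiableAt.hasFDerivAt i).fderiv
      rw [h1, ContinuousLinearMap.comp_apply, hu, map_zero]
    have hcoordD : ∀ i : Fin (m + d), HasFDerivAt (fun v : CSpace m d => v i)
        (ContinuousLinearMap.proj (R := ℂ) (φ := fun _ : Fin (m + d) => ℂ) i) (z (x : M)) :=
      fun i => (ContinuousLinearMap.proj (R := ℂ) (φ := fun _ : Fin (m + d) => ℂ) i).hasFDerivAt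
    have hn : ∀ r : Fin m, u (Fin.castAdd d r) = 0 := by
      intro r
      have h1 := hcomp (Fin.castAdd d r)
      simp only [hΦn] at h1
      rwa [(hcoordD _).fderiv] at h1
    have hku : killNormal u = u := killNormal_eq_self_iff.2 hn
    funext i
    refine Fin.addCases (fun r => hn r) (fun p => ?_) i
    have h1 := hcomp (Fin.natAdd m p)
    simp only [hΦt] at h1
    have hkd : HasFDerivAt (fun v : CSpace m d => killNormal v) (killNormalL m d) (z (x : M)) := by
      have := (killNormalL m d).hasFDerivAt (x := z (x : M))
      rwa [show ⇑(killNormalL m d) = killNormal from funext killNormalL_apply] at this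
    have h2 : HasFDerivAt (g p ∘ z.symm) (fderiv ℂ (g p ∘ z.symm) (z (x : M)))
        (killNormal (z (x : M))) := by
      rw [hk]; exact (hgx p).differentiableAt.hasFDerivAt
    have h3 := h2.comp (z (x : M)) hkd
    have h4 := ((hcoordD (Fin.natAdd m p)).sub_const (z (x : M) (Fin.natAdd m p))).congr_of_eventuallyEq
      (hgk p)
    have h5 := congrArg (fun L => L u) (h3.unique h4)
    simp only [ContinuousLinearMap.comp_apply, killNormalL_apply, hku] at h5
    exact h5.symm.trans h1
  have hW : (⋂ p, V p) ∈ 𝓝 (x : M) :=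
    Filter.iInter_mem.2 fun p => (hVo p).mem_nhds (hxV p)
  obtain ⟨w, hw, hxw, hwsrc, hwΦ⟩ := exists_chart_of_fderiv_injective hz hx hΦ hinj hW
  have hwS : w.source ∩ S = normalZeros w := by
    ext y
    constructor
    · rintro ⟨hy, hyS⟩
      refine ⟨hy, fun r => ?_⟩
      rw [hwΦ, hΦn]
      exact (hzS.le ⟨(hwsrc hy).1, hyS⟩).2 r
    · rintro ⟨hy, hy0⟩
      refine ⟨hy, (hzS.ge ⟨(hwsrc hy).1, fun r => ?_⟩).2⟩
      rw [← hΦn (z y) r, ← hwΦ]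
      exact hy0 r
  refine ⟨w, hw, hxw, hwS, ?_, fun y hy p => ?_⟩
  · rw [hwΦ]
    funext i
    refine Fin.addCases (fun r => ?_) (fun p => ?_) i
    · rw [hΦn]; exact killNormal_eq_self_iff.1 hk r
    · rw [hΦt]
      have := (hgk p).self_of_nhds
      rw [hk, sub_self] at this
      exact this
  · have hyV : (y : M) ∈ V p := Set.mem_iInter.1 (hwsrc hy).2 p
    have h1 : coordGerm hw hy (Fin.natAdd m p) = holGerm (g p) y (hg p y hyV) := by
      refine (holGerm_eq_iff (hf := holAt_coord hw hy _)).2 ?_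
      filter_upwards [z.open_source.eventually_mem (hwsrc hy).1] with y' hy'
      rw [hwΦ, hΦt, z.left_inv hy']
    rw [h1, ← hρ' p y hyV, ← sub_eq_zero, ← map_sub]
    exact ρ.stalkHom_eq_zero (hsub p y hyV)

/-- Every lifting admits an adapted atlas; only in dimension zero does the lifting have to be assumed
linear over the constants. -/
theorem Lifting.exists_isAdaptedTo (hS : IsComplexSubmanifold m d S) (ρ : Lifting m d S k)
    (h : 1 ≤ d ∨ ρ.FixesConstants) :
    ∃ 𝔘 : Set (OpenPartialHomeomorph M (CSpace m d)), IsAdaptedAtlas S 𝔘 ∧ IsAdaptedTo 𝔘 ρ := by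
  have hconst : ∀ (x : S) (c : ℂ), ρ.stalkHom x (constStalk m d (x : M) c)
      = Ideal.Quotient.mk _ (constStalk m d (x : M) c) := by
    intro x c
    rcases h with hd | hρ
    · obtain ⟨w, hw, hxw, hwS, hw0, hcoord⟩ := ρ.exists_chart hS x
      exact ρ.stalkHom_constStalk x hw hxw hwS ⟨0, hd⟩ (by simp [hw0]) (hcoord x hxw _) c
    · exact (ρ.maps_iff (HolAt.const c) (HolAt.const c)).1 (hρ x c)
  obtain ⟨𝔘, h𝔘, hP⟩ := exists_isAdaptedAtlas (S := S)
    (P := fun w => ∃ hw : IsHolChart w, ∀ (y : S) (hy : (y : M) ∈ w.source) (p : Fin d),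
      ρ.stalkHom y (coordGerm hw hy (Fin.natAdd m p))
        = Ideal.Quotient.mk _ (coordGerm hw hy (Fin.natAdd m p))) fun x hxS => by
      obtain ⟨w, hw, hxw, hwS, -, hcoord⟩ := ρ.exists_chart hS ⟨x, hxS⟩
      exact ⟨w, hw, hxw, hwS, hw, hcoord⟩
  refine ⟨𝔘, h𝔘, (isAdaptedTo_iff h𝔘 ρ).2 fun z hz x hx => ?_⟩
  obtain ⟨hz', hcoord⟩ := hP z hz ⟨x, hx, x.2⟩
  exact ρ.stalkHom_eq_of_coord hz' hx (h𝔘.inter_eq_normalZeros hz hx x.2) _ (hconst x)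
    (hcoord x hx)

end AdaptedChart

theorem theorem2p1 {m d : ℕ} (hm : 1 ≤ m) {M : Type*} [TopologicalSpace M] [T2Space M]
    [ChartedSpace (CSpace m d) M] [IsManifold 𝓘(ℂ, CSpace m d) ω M]
    (S : Set M) (hS : IsComplexSubmanifold m d S) (k : ℕ) (hk : 1 ≤ k) :
    -- (i)
    (IsKSplitting m d S k ↔
      ∃ 𝔘 : Set (OpenPartialHomeomorph M (CSpace m d)),
        IsAdaptedAtlas S 𝔘 ∧ IsKSplittingAtlas S k 𝔘) ∧
    -- (ii)
    (∀ 𝔘 : Set (OpenPartialHomeomorph M (CSpace m d)), IsAdaptedAtlas S 𝔘 →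
      (IsKSplittingAtlas S k 𝔘 ↔ ∃ ρ : Lifting m d S k, IsAdaptedTo 𝔘 ρ)) ∧
    -- (iii)
    (∀ 𝔘 : Set (OpenPartialHomeomorph M (CSpace m d)), IsAdaptedAtlas S 𝔘 → IsProjectable S 𝔘 →
      (IsKSplittingAtlas S k 𝔘 ↔ ∃ ρ : Lifting m d S k, LocalLiftingsPatchTo 𝔘 ρ)) ∧
    -- (iv)
    (IsKSplitting m d S k → ∀ ρ : Lifting m d S k, (1 ≤ d ∨ ρ.FixesConstants) →
      ∃ 𝔘 : Set (OpenPartialHomeomorph M (CSpace m d)),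
        IsAdaptedAtlas S 𝔘 ∧ IsAdaptedTo 𝔘 ρ) := by
  refine ⟨⟨?_, ?_⟩, fun 𝔘 h𝔘 => isKSplittingAtlas_iff_exists_isAdaptedTo h𝔘,
    fun 𝔘 h𝔘 _ => isKSplittingAtlas_iff_exists_localLiftingsPatchTo h𝔘,
    fun _ ρ hρ => ρ.exists_isAdaptedTo hS hρ⟩
  · rintro ⟨ρ⟩
    rcases Nat.eq_zero_or_pos d with rfl | hd
    · -- without tangential coordinates the splitting condition is empty
      obtain ⟨𝔘, h𝔘, -⟩ := exists_isAdaptedAtlas (S := S) (P := fun _ => True) fun x hx => by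
        obtain ⟨z, hz, hxz, hzS⟩ := hS x hx
        exact ⟨z, hz, hxz, hzS, trivial⟩
      exact ⟨𝔘, h𝔘, fun _ _ _ _ _ _ p => p.elim0⟩
    · obtain ⟨𝔘, h𝔘, hρ⟩ := ρ.exists_isAdaptedTo hS (Or.inl hd)
      exact ⟨𝔘, h𝔘, (isKSplittingAtlas_iff_exists_isAdaptedTo h𝔘).2 ⟨ρ, hρ⟩⟩
  · rintro ⟨𝔘, h𝔘, hsplit⟩
    obtain ⟨ρ, -⟩ := (isKSplittingAtlas_iff_exists_isAdaptedTo h𝔘).1 hsplit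
    exact ⟨ρ⟩
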